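/- For $L\ge\frac12$ let $\Omega_{2L}:=(0,2L)\times(0,1)\subset\mathbb{R}^2$ and \[ \mathcal X:=\{u\in W^{1,2}_{\mathrm{loc}}(\mathbb{R}^2;\mathbb{R}^2):\ \partial_iu_j\in BV(\Omega_{2L})\text{ for } i,j\in\{1,2\},\ \nabla u\in L^2(\mathbb{R}^2;\mathbb{R}^{2\times2})\}. \] For $\mu>0$, $\varepsilon>0$, $\theta\in(0,\frac12]$ and $u\in\mathcal X$ define \[ I(u):=\mu\int_{\mathbb{R}^2\setminus\Omega_{2L}}|\nabla u|^2\,d\mathcal L^2+\int_{\Omega_{2L}}\min\{|e(u)-\theta\, e_1\odot e_2|^2,\ |e(u)+(1-\theta)\,e_1\odot e_2|^2\}\,d\mathcal L^2+\varepsilon|D^2u|(\Omega_{2L}), \] where $e(u):=\frac12(\nabla u+\nabla^Tu)$, $e_1\odot e_2:=\frac12(e_1\otimes e_2+e_2\otimes e_1)$, $|\cdot|$ is the Euclidean norm of matrices, and $|D^2u|(\Omega_{2L})$ is the total variation on $\Omega_{2L}$ of the second distributional derivative of $u$. Then there exists a constant $c>0$ (independent of all parameters and of $u$) such that for all $\mu>0$,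 $\varepsilon>0$, $\theta\in(0,\frac12]$, $L\in[\frac12,\infty)$ with $\min\{\theta^2,\mu\theta^2\}\le\varepsilon$ and all $u\in\mathcal X$, \[ I(u)\ \ge\ c\,\min\Big\{\mu\theta^2\ln(3+L),\ \theta^2L,\ \mu\theta^2\ln\Big(3+\frac L\mu\Big)+\varepsilon\theta\Big\}. \] -/

import Mathlib

open MeasureTheory Set
open scoped ENNReal ContDiff

noncomputable section

namespace Nucleus

/-- The plane `ℝ²` with its Lebesgue measure; no norm of the plane is used below. -/
abbrev Plane : Type := ℝ × ℝ

/-- The partial derivative `∂ₖ φ`, `k ∈ {0, 1}`, of a (differentiable) scalar function. -/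
def partialDeriv (k : Fin 2) (φ : Plane → ℝ) (x : Plane) : ℝ :=
  fderiv ℝ φ x ((![(1, 0), (0, 1)] : Fin 2 → Plane) k)

/-- The martensitic nucleus `Ω_{2L} = (0, 2L) × (0, 1)`. -/
def nucleus (L : ℝ) : Set Plane := Ioo 0 (2 * L) ×ˢ Ioo 0 1

/-- `G` is a weak gradient of `u` on `ℝ²`: `G x i j = ∂ᵢ uⱼ (x)`, tested against `C_c^∞(ℝ²)`. -/
def IsWeakGradient (u : Plane → Fin 2 → ℝ) (G : Plane → Matrix (Fin 2) (Fin 2) ℝ) : Prop :=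
  (∀ j, LocallyIntegrable (fun x => u x j) volume) ∧
  (∀ i j, LocallyIntegrable (fun x => G x i j) volume) ∧
  ∀ i j, ∀ φ : Plane → ℝ, ContDiff ℝ ∞ φ → HasCompactSupport φ →
    ∫ x, u x j * partialDeriv i φ x = -∫ x, G x i j * φ x

open Classical in
/-- The weak gradient `∇u` (unique almost everywhere, see `IsWeakGradient.ae_eq`);
the value `0` is used if there is none. -/
def weakGradient (u : Plane → Fin 2 → ℝ) : Plane → Matrix (Fin 2) (Fin 2) ℝ :=
  if h : ∃ G, IsWeakGradient u G then h.choose else 0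

theorem isWeakGradient_weakGradient {u : Plane → Fin 2 → ℝ} (h : ∃ G, IsWeakGradient u G) :
    IsWeakGradient u (weakGradient u) := by
  unfold weakGradient
  rw [dif_pos h]
  exact h.choose_spec

theorem IsWeakGradient.ae_eq {u : Plane → Fin 2 → ℝ} {G H : Plane → Matrix (Fin 2) (Fin 2) ℝ}
    (hG : IsWeakGradient u G) (hH : IsWeakGradient u H) : ∀ᵐ x, G x = H x := by
  have key : ∀ i j, ∀ᵐ x, G x i j = H x i j := by
    intro i j
    refine ae_eq_of_integral_contDiff_smul_eq (hG.2.1 i j) (hH.2.1 i j) fun φ hφ hc => ?_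
    have h1 := hG.2.2 i j φ hφ hc
    have h2 := hH.2.2 i j φ hφ hc
    simp only [smul_eq_mul, mul_comm (φ _)]
    linarith
  filter_upwards [ae_all_iff.2 fun i => ae_all_iff.2 (key i)] with x hx
  ext i j
  exact hx i j

/-- `f ∈ L²_loc(ℝ²)`. -/
def MemL2Loc (f : Plane → ℝ) : Prop :=
  ∀ K : Set Plane, IsCompact K → MemLp f 2 (volume.restrict K)

/-- `u ∈ W^{1,2}_loc(ℝ²; ℝ²)`. -/
def MemW12Loc (u : Plane → Fin 2 → ℝ) : Prop :=
  (∀ j, MemL2Loc fun x => u x j) ∧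
  ∃ G, IsWeakGradient u G ∧ ∀ i j, MemL2Loc fun x => G x i j

/-- Test fields for the total variation: `φ ∈ C_c^∞(Ω; ℝ^{ι × 2})` with Euclidean norm at most `1`
at every point. -/
def IsTestField {ι : Type} [Fintype ι] (Ω : Set Plane) (φ : Plane → ι → Fin 2 → ℝ) : Prop :=
  ContDiff ℝ ∞ φ ∧ HasCompactSupport φ ∧ tsupport φ ⊆ Ω ∧ ∀ x, ∑ i, ∑ k, φ x i k ^ 2 ≤ 1

/-- The total variation `|Df|(Ω)` of the distributional derivative of `f : Ω → ℝ^ι` on the open set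
`Ω`, with respect to the Euclidean norm of `ℝ^{ι × 2}`. It is `∞` if `Df` is not a finite measure
on `Ω`. -/
def totalVariation {ι : Type} [Fintype ι] (Ω : Set Plane) (f : Plane → ι → ℝ) : ℝ≥0∞ :=
  ⨆ (φ : Plane → ι → Fin 2 → ℝ) (_ : IsTestField Ω φ),
    ENNReal.ofReal (∑ i, ∑ k, ∫ x in Ω, f x i * partialDeriv k (fun y => φ y i k) x)

/-- `f ∈ BV(Ω)` for a scalar function `f`. -/
def MemBV (Ω : Set Plane) (f : Plane → ℝ) : Prop :=
  IntegrableOn f Ω volume ∧ totalVariation Ω (fun x (_ : Unit) => f x) < ⊤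

/-- The space `𝒳` of functions `u ∈ W^{1,2}_loc(ℝ²; ℝ²)` with `∂ᵢ uⱼ ∈ BV(Ω_{2L})` for all `i, j`
and `∇u ∈ L²(ℝ²; ℝ^{2 × 2})`. -/
def admissible (L : ℝ) : Set (Plane → Fin 2 → ℝ) :=
  {u | MemW12Loc u ∧
    (∀ i j, MemBV (nucleus L) fun x => weakGradient u x i j) ∧
    ∀ i j, MemLp (fun x => weakGradient u x i j) 2 volume}

/-- The squared Euclidean norm `|A|² = ∑ᵢⱼ Aᵢⱼ²` of a matrix. -/
def normSq (A : Matrix (Fin 2) (Fin 2) ℝ) : ℝ := ∑ i, ∑ j, A i j ^ 2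

/-- The symmetric part of a matrix. -/
def symPart (A : Matrix (Fin 2) (Fin 2) ℝ) : Matrix (Fin 2) (Fin 2) ℝ :=
  (1 / 2 : ℝ) • (A + A.transpose)

/-- The matrix `e₁ ⊙ e₂ = (e₁ ⊗ e₂)_sym`. -/
def e₁e₂ : Matrix (Fin 2) (Fin 2) ℝ := symPart (Matrix.vecMulVec ![1, 0] ![0, 1])

/-- The linear strain `e(u) = (∇u)_sym`. -/
def strain (u : Plane → Fin 2 → ℝ) (x : Plane) : Matrix (Fin 2) (Fin 2) ℝ :=
  symPart (weakGradient u x)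

/-- The energy
`I(u) = μ ∫_{ℝ² \ Ω_{2L}} |∇u|² + ∫_{Ω_{2L}} min{|e(u) - θ e₁⊙e₂|², |e(u) + (1-θ) e₁⊙e₂|²}
  + ε |D²u|(Ω_{2L})`, with values in `[0, ∞]`. -/
def energy (μ ε θ L : ℝ) (u : Plane → Fin 2 → ℝ) : ℝ≥0∞ :=
  ENNReal.ofReal μ * (∫⁻ x in (nucleus L)ᶜ, ENNReal.ofReal (normSq (weakGradient u x))) +
  (∫⁻ x in nucleus L, ENNReal.ofReal
    (min (normSq (strain u x - θ • e₁e₂)) (normSq (strain u x + (1 - θ) • e₁e₂)))) +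
  ENNReal.ofReal ε *
    totalVariation (nucleus L) (fun x (p : Fin 2 × Fin 2) => weakGradient u x p.1 p.2)

end Nucleus

end

/-!
The scalar function `w = u₁ + u₂`, the component of `u` along `ξ = (1, 1)`, carries the whole
argument. Its derivative `f = ∂₁w + ∂₂w = ξ · e(u) ξ` along the diagonal `ξ` depends on the strain
only, and the two wells of the strain become the values `θ` and `θ - 1` of `f`; the energy density in
the nucleus is at least a quarter of the squared distance of `f` to `{θ, θ - 1}` (`sq_wellDist_le`).

For `s ∈ (-1/2, 2L - 1)` consider the closed triangle with hypotenuse on the diagonal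
`x₂ = x₁ - s`, vertical leg on `x₁ = -(s + 1)` and horizontal leg on `x₂ = s + 2`. Its hypotenuse
crosses the nucleus, everything else lies in the exterior, and its length is of order `s + 1`. Since
the derivative of `w` integrates to zero along the triangle, the integral `A s` of `f` over the
crossing is bounded by the integral of `|∇w|` over the exterior part of the triangle
(`enorm_integral_diagonal_le`). On the crossing there are three possibilities: `f` varies by at least
`1/4`, it is far from the wells in the mean, or `|A s|` is of order `θ` (`well_lower_bound`).
Integrating over `s` against the weight `M / (M + s + 1)` with `M = max 1 μ`
(`weighted_lower_bound`) and using the Cauchy-Schwarz inequality on the exterior and elastic terms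
gives `I(u) ≳ μ θ² ln(1 + L / (2M))` (`energy_ge_log`); the hypothesis `min {θ², μθ²} ≤ ε` is used to
estimate the lines on which `f` varies much. This is the claim for `μ ≤ 1` and for `L ≤ μ`.

For `L ≥ μ ≥ 1` it remains to bound the energy from below by the minimum of `μ θ² ln(3 + L)`, `θ² L`
and `ε θ`. The integrals `A s` over two parallel crossings differ at most by the variation of `f`, so
if the variation is much smaller than `θ`, then either every crossing has `|A s|` of order `θ`,
which costs the logarithm, or every crossing is far from the wells, which costs `θ² L`
(`averaged_lower_bound`, `energy_ge_min`).

All this is done for mollifications of `w`, whose gradients converge to `∇w` in `L¹` on bounded sets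
(`exists_lintegral_mollify_sub_le`), and for which the variation of `f` becomes the integral of
a derivative over a slightly smaller rectangle (`lintegral_fderiv_mollify_le`).
-/

namespace Nucleus

open Metric Filter Topology
open scoped Convolution

/-! ### Mollification -/

/-- The mollification `ρ ⋆ g` of `g`, where `ρ` is the normalised bump function of `φ`. -/
noncomputable def mollify (φ : ContDiffBump (0 : Plane)) (g : Plane → ℝ) : Plane → ℝ :=
  φ.normed volume ⋆[ContinuousLinearMap.lsmul ℝ ℝ, volume] g

theorem contDiff_mollify (φ : ContDiffBump (0 : Plane)) {g : Plane → ℝ}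
    (hg : LocallyIntegrable g volume) : ContDiff ℝ ∞ (mollify φ g) :=
  φ.hasCompactSupport_normed.contDiff_convolution_left _ (n := ⊤) φ.contDiff_normed hg

theorem mollify_apply (φ : ContDiffBump (0 : Plane)) (g : Plane → ℝ) (x : Plane) :
    mollify φ g x = ∫ y, φ.normed volume (x - y) * g y := by
  simp [mollify, convolution_lsmul_swap]

theorem contDiff_normed_sub (φ : ContDiffBump (0 : Plane)) (x : Plane) :
    ContDiff ℝ ∞ fun y => φ.normed volume (x - y) :=
  (φ.contDiff_normed (μ := volume) (n := ⊤)).comp (contDiff_const.sub contDiff_id)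

theorem hasCompactSupport_normed_sub (φ : ContDiffBump (0 : Plane)) (x : Plane) :
    HasCompactSupport fun y => φ.normed volume (x - y) :=
  (φ.hasCompactSupport_normed (μ := volume)).comp_homeomorph (Homeomorph.subLeft x)

theorem fderiv_mollify_apply (φ : ContDiffBump (0 : Plane)) {g : Plane → ℝ}
    (hg : LocallyIntegrable g volume) (x d : Plane) :
    fderiv ℝ (mollify φ g) x d = ∫ y, fderiv ℝ (φ.normed volume) (x - y) d * g y := by
  have h1 : ContDiff ℝ 1 (φ.normed (volume : Measure Plane)) := φ.contDiff_normed (n := 1)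
  have h2 := φ.hasCompactSupport_normed (μ := (volume : Measure Plane))
  have h := h2.hasFDerivAt_convolution_left (ContinuousLinearMap.lsmul ℝ ℝ) h1 hg x
  rw [mollify, h.fderiv, convolution_eq_swap]
  have hint : Integrable (fun t =>
      ((ContinuousLinearMap.lsmul ℝ ℝ : ℝ →L[ℝ] ℝ →L[ℝ] ℝ).precompL Plane)
        (fderiv ℝ (φ.normed volume) (x - t)) (g t)) volume :=
    ((h2.fderiv ℝ).convolutionExists_left _ (h1.continuous_fderiv one_ne_zero) hg x).integrable_swap
  rw [ContinuousLinearMap.integral_apply hint]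
  simp [ContinuousLinearMap.precompL_apply]

theorem fderiv_normed_sub (φ : ContDiffBump (0 : Plane)) (x y d : Plane) :
    fderiv ℝ (fun z => φ.normed volume (x - z)) y d = -fderiv ℝ (φ.normed volume) (x - y) d := by
  have h1 : DifferentiableAt ℝ (φ.normed (volume : Measure Plane)) (x - y) :=
    (φ.contDiff_normed (n := 1)).differentiable one_ne_zero _
  have h2 : HasFDerivAt (fun z : Plane => x - z) (-ContinuousLinearMap.id ℝ Plane) y :=
    (hasFDerivAt_id y).const_sub x
  have := (h1.hasFDerivAt.comp y h2).fderiv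
  simp only [Function.comp_def] at this
  rw [this]
  simp

/-- Mollification commutes with weak differentiation. -/
theorem partialDeriv_mollify (φ : ContDiffBump (0 : Plane)) {w g : Plane → ℝ} {k : Fin 2}
    (hw : LocallyIntegrable w volume)
    (h : ∀ ψ : Plane → ℝ, ContDiff ℝ ∞ ψ → HasCompactSupport ψ →
      ∫ x, w x * partialDeriv k ψ x = -∫ x, g x * ψ x) (x : Plane) :
    partialDeriv k (mollify φ w) x = mollify φ g x := by
  have := h _ (contDiff_normed_sub φ x) (hasCompactSupport_normed_sub φ x)
  rw [partialDeriv, fderiv_mollify_apply φ hw, mollify_apply]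
  simp only [partialDeriv, fderiv_normed_sub, mul_neg, integral_neg, neg_inj] at this
  simp only [mul_comm _ (w _), mul_comm _ (g _), this]

/-- Young's inequality for the `L¹` norm. -/
theorem lintegral_enorm_mollify_le (φ : ContDiffBump (0 : Plane)) {g : Plane → ℝ}
    (hg : AEStronglyMeasurable g volume) :
    ∫⁻ x, ‖mollify φ g x‖ₑ ≤ ∫⁻ x, ‖g x‖ₑ := by
  have hρ : ∫⁻ y, ‖φ.normed (volume : Measure Plane) y‖ₑ = 1 := by
    have h := φ.integral_normed (μ := (volume : Measure Plane))
    have : ∀ y, ‖φ.normed (volume : Measure Plane) y‖ₑ = ENNReal.ofReal (φ.normed volume y) :=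
      fun y => Real.enorm_of_nonneg (φ.nonneg_normed y)
    simp_rw [this]
    rw [← ofReal_integral_eq_lintegral_ofReal φ.integrable_normed
      (Eventually.of_forall φ.nonneg_normed), h, ENNReal.ofReal_one]
  have hm : Measurable (φ.normed (volume : Measure Plane)) := φ.continuous_normed.measurable
  calc ∫⁻ x, ‖mollify φ g x‖ₑ
      ≤ ∫⁻ x, ∫⁻ y, ‖φ.normed (volume : Measure Plane) (x - y)‖ₑ * ‖g y‖ₑ := by
        refine lintegral_mono fun x => ?_
        rw [mollify_apply]
        refine (enorm_integral_le_lintegral_enorm _).trans (le_of_eq ?_)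
        simp_rw [enorm_mul]
    _ = ∫⁻ y, ∫⁻ x, ‖φ.normed (volume : Measure Plane) (x - y)‖ₑ * ‖g y‖ₑ := by
        refine lintegral_lintegral_swap ?_
        exact ((hm.comp (measurable_fst.sub measurable_snd)).enorm.aemeasurable).mul
          (hg.enorm.comp_quasiMeasurePreserving Measure.quasiMeasurePreserving_snd)
    _ = ∫⁻ y, ‖g y‖ₑ := by
        refine lintegral_congr fun y => ?_
        have hmy : Measurable fun x => φ.normed (volume : Measure Plane) (x - y) :=
          hm.comp (measurable_id.sub_const y)
        rw [lintegral_mul_const _ hmy.enorm]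
        have : ∫⁻ x, ‖φ.normed (volume : Measure Plane) (x - y)‖ₑ = 1 := by
          rw [← hρ]
          exact lintegral_sub_right_eq_self (fun x => ‖φ.normed (volume : Measure Plane) x‖ₑ) y
        simp [this]

/-- Mollifications of a locally integrable function converge in `L¹` on bounded sets. -/
theorem exists_lintegral_mollify_sub_le {g : Plane → ℝ} (hg : LocallyIntegrable g volume)
    (R : ℝ) {η : ℝ≥0∞} (hη : η ≠ 0) :
    ∃ r > 0, ∀ φ : ContDiffBump (0 : Plane), φ.rOut < r →
      ∫⁻ x in closedBall 0 R, ‖mollify φ g x - g x‖ₑ ≤ η := by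
  have hη3 : η / 3 ≠ 0 := by simp [hη]
  set g₁ : Plane → ℝ := (closedBall 0 (R + 1)).indicator g with hg₁
  have hg₁i : Integrable g₁ volume :=
    (integrable_indicator_iff measurableSet_closedBall).2
      (hg.integrableOn_isCompact (isCompact_closedBall _ _))
  obtain ⟨h, hhc, hhη, hcont, hhi⟩ := hg₁i.exists_hasCompactSupport_lintegral_sub_le hη3
  have hvol : volume (closedBall (0 : Plane) R) ≠ ⊤ := measure_closedBall_lt_top.ne
  obtain ⟨κ, hκ, hκη⟩ : ∃ κ : ℝ, 0 < κ ∧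
      ENNReal.ofReal κ * volume (closedBall (0 : Plane) R) ≤ η / 3 := by
    obtain ⟨κ, hκ, h⟩ := ENNReal.exists_nnreal_pos_mul_lt hvol hη3
    exact ⟨κ, hκ, by simpa using h.le⟩
  obtain ⟨r, hr, hrκ⟩ := Metric.uniformContinuous_iff.1
    (hhc.uniformContinuous_of_continuous hcont) κ hκ
  refine ⟨min r 1, lt_min hr one_pos, fun φ hφ => ?_⟩
  have hsub : Integrable (fun x => g₁ x - h x) volume := hg₁i.sub hhi
  have key : ∀ x ∈ closedBall (0 : Plane) R, ‖mollify φ g x - g x‖ₑ ≤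
      ‖mollify φ (fun y => g₁ y - h y) x‖ₑ + ENNReal.ofReal κ + ‖g₁ x - h x‖ₑ := by
    intro x hx
    have e1 : mollify φ g x = mollify φ g₁ x := by
      rw [mollify_apply, mollify_apply]
      refine integral_congr_ae (Eventually.of_forall fun y => ?_)
      by_cases hy : y ∈ closedBall (0 : Plane) (R + 1)
      · simp [hg₁, indicator_of_mem hy]
      · have : φ.normed volume (x - y) = 0 := by
          rw [← Function.notMem_support, φ.support_normed_eq]
          intro hxy
          apply hy
          rw [mem_closedBall_zero_iff] at hx ⊢
          rw [mem_ball_zero_iff] at hxy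
          have := hφ.trans_le (min_le_right _ _)
          calc ‖y‖ = ‖x - (x - y)‖ := by simp
            _ ≤ ‖x‖ + ‖x - y‖ := norm_sub_le _ _
            _ ≤ R + 1 := by linarith
        simp [this]
    have e2 : g x = g₁ x := by
      rw [hg₁, indicator_of_mem (closedBall_subset_closedBall (by linarith) hx)]
    have e3 : mollify φ g₁ x = mollify φ (fun y => g₁ y - h y) x + mollify φ h x := by
      have i1 : ∀ {k : Plane → ℝ}, LocallyIntegrable k volume →
          Integrable (fun y => φ.normed volume (x - y) * k y) volume := fun hk => by
        have := (φ.hasCompactSupport_normed (μ := (volume : Measure Plane))).convolutionExists_left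
          (ContinuousLinearMap.lsmul ℝ ℝ) φ.continuous_normed hk x
        simpa using this.integrable_swap
      simp only [mollify_apply]
      rw [← integral_add (i1 hsub.locallyIntegrable) (i1 hhi.locallyIntegrable)]
      congr 1 with y
      ring
    have e4 : dist (mollify φ h x) (h x) ≤ κ :=
      φ.dist_normed_convolution_le hcont.aestronglyMeasurable fun y hy =>
        (hrκ ((mem_ball.1 hy).trans (hφ.trans_le (min_le_left _ _)))).le
    calc ‖mollify φ g x - g x‖ₑ
        = ‖mollify φ (fun y => g₁ y - h y) x + (mollify φ h x - h x) - (g₁ x - h x)‖ₑ := by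
          rw [e1, e2, e3]; congr 1; ring
      _ ≤ ‖mollify φ (fun y => g₁ y - h y) x‖ₑ + ‖mollify φ h x - h x‖ₑ + ‖g₁ x - h x‖ₑ :=
          enorm_sub_le.trans (by gcongr; exact enorm_add_le _ _)
      _ ≤ _ := by
          gcongr
          rw [← ofReal_norm, ← dist_eq_norm]
          exact ENNReal.ofReal_le_ofReal e4
  calc ∫⁻ x in closedBall 0 R, ‖mollify φ g x - g x‖ₑ
      ≤ ∫⁻ x in closedBall 0 R, (‖mollify φ (fun y => g₁ y - h y) x‖ₑ + ENNReal.ofReal κ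
          + ‖g₁ x - h x‖ₑ) := setLIntegral_mono' measurableSet_closedBall key
    _ = (∫⁻ x in closedBall 0 R, ‖mollify φ (fun y => g₁ y - h y) x‖ₑ)
        + ENNReal.ofReal κ * volume (closedBall (0 : Plane) R)
        + ∫⁻ x in closedBall 0 R, ‖g₁ x - h x‖ₑ := by
        have hc : Measurable (mollify φ (fun y => g₁ y - h y)) :=
          (contDiff_mollify φ hsub.locallyIntegrable).continuous.measurable
        rw [lintegral_add_left (hc.enorm.add_const _), lintegral_add_left hc.enorm,
          setLIntegral_const]
    _ ≤ η / 3 + η / 3 + η / 3 := by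
        gcongr
        · exact (setLIntegral_le_lintegral _ _).trans
            ((lintegral_enorm_mollify_le φ hsub.aestronglyMeasurable).trans hhη)
        · exact (setLIntegral_le_lintegral _ _).trans hhη
    _ = η := ENNReal.add_thirds η

/-! ### Variation of mollified functions -/

/-- The total variation on `Ω` of the derivative of the scalar function `f` in the direction `d`,
defined by duality. -/
noncomputable def directionalVariation (Ω : Set Plane) (f : Plane → ℝ) (d : Plane) : ℝ≥0∞ :=
  ⨆ (ψ : Plane → ℝ) (_ : ContDiff ℝ ∞ ψ ∧ HasCompactSupport ψ ∧ tsupport ψ ⊆ Ω ∧ ∀ x, |ψ x| ≤ 1),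
    ENNReal.ofReal (∫ x in Ω, f x * fderiv ℝ ψ x d)

theorem ofReal_integral_le_directionalVariation {Ω : Set Plane} (f : Plane → ℝ) (d : Plane)
    {ψ : Plane → ℝ} (h : ContDiff ℝ ∞ ψ) (hc : HasCompactSupport ψ) (hs : tsupport ψ ⊆ Ω)
    (h1 : ∀ x, |ψ x| ≤ 1) :
    ENNReal.ofReal (∫ x in Ω, f x * fderiv ℝ ψ x d) ≤ directionalVariation Ω f d :=
  le_iSup₂_of_le (f := fun (ψ : Plane → ℝ) (_ : ContDiff ℝ ∞ ψ ∧ HasCompactSupport ψ ∧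
    tsupport ψ ⊆ Ω ∧ ∀ x, |ψ x| ≤ 1) => ENNReal.ofReal (∫ x in Ω, f x * fderiv ℝ ψ x d))
    ψ ⟨h, hc, hs, h1⟩ le_rfl

theorem fderiv_normed_neg (φ : ContDiffBump (0 : Plane)) (x d : Plane) :
    fderiv ℝ (φ.normed volume) (-x) d = -fderiv ℝ (φ.normed volume) x d := by
  have h := fderiv_normed_sub φ 0 x d
  simp only [zero_sub, φ.normed_neg] at h
  have e : (fun z => φ.normed (volume : Measure Plane) z) = φ.normed volume := rfl
  rw [e] at h
  linarith

theorem tsupport_mollify_subset (φ : ContDiffBump (0 : Plane)) {ψ : Plane → ℝ} {K : Set Plane}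
    {r : ℝ} (hr : 0 ≤ r) (hψ : tsupport ψ ⊆ cthickening r K) :
    tsupport (mollify φ ψ) ⊆ cthickening (φ.rOut + r) K := by
  refine closure_minimal (fun x hx => ?_) isClosed_cthickening
  obtain ⟨a, ha, b, hb, rfl⟩ := support_convolution_subset _ hx
  rw [φ.support_normed_eq, mem_ball_zero_iff] at ha
  refine cthickening_cthickening_subset φ.rOut_pos.le hr K ?_
  refine mem_cthickening_of_dist_le _ b _ _ (hψ (subset_tsupport _ hb)) ?_
  simpa [dist_eq_norm] using ha.le

theorem abs_mollify_le_one (φ : ContDiffBump (0 : Plane)) {ψ : Plane → ℝ} (hψ : ∀ x, |ψ x| ≤ 1)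
    (x : Plane) : |mollify φ ψ x| ≤ 1 := by
  rw [mollify_apply, ← Real.norm_eq_abs]
  have hi : Integrable (fun y => φ.normed (volume : Measure Plane) (x - y)) volume :=
    φ.integrable_normed.comp_sub_left x
  calc ‖∫ y, φ.normed volume (x - y) * ψ y‖
      ≤ ∫ y, φ.normed volume (x - y) := by
        refine norm_integral_le_of_norm_le hi (Eventually.of_forall fun y => ?_)
        rw [norm_mul, Real.norm_of_nonneg (φ.nonneg_normed _)]
        exact mul_le_of_le_one_right (φ.nonneg_normed _) (hψ y)
    _ = 1 := by
        rw [integral_sub_left_eq_self (fun y => φ.normed volume y) volume x, φ.integral_normed]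

/-- Moving the mollifier and the derivative from `f` to the test function. -/
theorem integral_fderiv_mollify_mul (φ : ContDiffBump (0 : Plane)) {f ψ : Plane → ℝ}
    (hf : LocallyIntegrable f volume) (hψ : Continuous ψ) (hc : HasCompactSupport ψ) (d : Plane) :
    ∫ x, fderiv ℝ (mollify φ f) x d * ψ x = -∫ y, f y * fderiv ℝ (mollify φ ψ) y d := by
  set ρ' : Plane → ℝ := fun z => fderiv ℝ (φ.normed volume) z d with hρ'
  have hρc : Continuous ρ' := ((φ.contDiff_normed (n := 1)).continuous_fderiv one_ne_zero).clm_apply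
    continuous_const
  have hρs : HasCompactSupport ρ' :=
    ((φ.hasCompactSupport_normed (μ := (volume : Measure Plane))).fderiv ℝ).comp_left
      (g := fun L : Plane →L[ℝ] ℝ => L d) rfl
  -- `f` may be truncated to a compact set outside of which the integrand vanishes
  set C : Set Plane := cthickening φ.rOut (tsupport ψ) with hC
  have hCc : IsCompact C := hc.isCompact.cthickening
  have hfi : Integrable (C.indicator f) volume :=
    (integrable_indicator_iff hCc.measurableSet).2 (hf.integrableOn_isCompact hCc)
  have hprod : Integrable (fun p : Plane × Plane => ρ' (p.1 - p.2) * (ψ p.1 * C.indicator f p.2))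
      (volume.prod volume) := by
    obtain ⟨M, hM⟩ := hρs.exists_bound_of_continuous hρc
    exact ((hψ.integrable_of_hasCompactSupport hc).mul_prod hfi).bdd_mul (c := M)
      (hρc.comp (continuous_fst.sub continuous_snd)).aestronglyMeasurable
      (Eventually.of_forall fun p => hM _)
  have e : ∀ x y, ρ' (x - y) * (ψ x * C.indicator f y) = ρ' (x - y) * f y * ψ x := by
    intro x y
    by_cases hy : y ∈ C
    · rw [indicator_of_mem hy]; ring
    by_cases hx : x ∈ tsupport ψ
    · have : ρ' (x - y) = 0 := by
        by_contra hne
        apply hy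
        refine mem_cthickening_of_dist_le y x _ _ hx ?_
        have h1 : x - y ∈ tsupport (φ.normed (volume : Measure Plane)) := by
          by_contra h
          apply hne
          rw [hρ']
          simp [fderiv_of_notMem_tsupport (𝕜 := ℝ) h]
        rw [φ.tsupport_normed_eq, mem_closedBall_zero_iff] at h1
        rwa [dist_comm, dist_eq_norm]
      simp [this]
    · simp [image_eq_zero_of_notMem_tsupport hx]
  calc ∫ x, fderiv ℝ (mollify φ f) x d * ψ x
      = ∫ x, ∫ y, ρ' (x - y) * (ψ x * C.indicator f y) := by
        congr 1 with x
        simp_rw [e]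
        rw [fderiv_mollify_apply φ hf, integral_mul_const]
    _ = ∫ y, ∫ x, ρ' (x - y) * (ψ x * C.indicator f y) := integral_integral_swap hprod
    _ = ∫ y, -(f y * fderiv ℝ (mollify φ ψ) y d) := by
        congr 1 with y
        simp_rw [e]
        rw [fderiv_mollify_apply φ hψ.locallyIntegrable, ← integral_const_mul, ← integral_neg]
        congr 1 with x
        rw [← neg_sub x y, fderiv_normed_neg]
        ring
    _ = _ := integral_neg _

theorem exists_contDiff_cutoff {K : Set Plane} (hK : IsCompact K) {r : ℝ} (hr : 0 < r) :
    ∃ χ : Plane → ℝ, ContDiff ℝ ∞ χ ∧ (∀ x ∈ K, χ x = 1) ∧ tsupport χ ⊆ cthickening r K ∧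
      ∀ x, χ x ∈ Icc 0 1 := by
  obtain ⟨χ, h1, h0, h01⟩ := exists_contMDiffMap_one_nhds_of_subset_interior (n := (⊤ : ℕ∞))
    (modelWithCornersSelf ℝ Plane) (t := cthickening r K) hK.isClosed
    ((self_subset_thickening hr K).trans
      (isOpen_thickening.subset_interior_iff.2 (thickening_subset_cthickening r K)))
  refine ⟨χ, χ.contMDiff.contDiff, fun x hx => h1.self_of_nhdsSet x hx, ?_, h01⟩
  refine closure_minimal (fun x hx => ?_) isClosed_cthickening
  by_contra h
  exact hx (h0 x h)

theorem abs_le_sq_div_sqrt_add (h : ℝ) {κ : ℝ} (hκ : 0 < κ) :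
    |h| ≤ h ^ 2 / √(h ^ 2 + κ ^ 2) + κ := by
  have hpos : 0 < √(h ^ 2 + κ ^ 2) := Real.sqrt_pos.2 (by positivity)
  have hle : √(h ^ 2 + κ ^ 2) ≤ |h| + κ := by
    rw [Real.sqrt_le_left (by positivity)]
    nlinarith [sq_abs h, abs_nonneg h]
  rw [← sub_le_iff_le_add, le_div_iff₀ hpos]
  rcases le_total (|h| - κ) 0 with h0 | h0
  · nlinarith [sq_nonneg h]
  · nlinarith [sq_abs h]

/-- Mollification does not increase the variation, up to shrinking the domain. The supremum in the
definition of the variation is tested with a regularised sign of the derivative of `ρ ⋆ f`. -/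
theorem lintegral_fderiv_mollify_le (φ : ContDiffBump (0 : Plane)) {f : Plane → ℝ}
    (hf : LocallyIntegrable f volume) (d : Plane) {Ω K : Set Plane} (hΩ : MeasurableSet Ω)
    (hK : IsCompact K) (hKΩ : cthickening (2 * φ.rOut) K ⊆ Ω) :
    ∫⁻ x in K, ‖fderiv ℝ (mollify φ f) x d‖ₑ ≤ directionalVariation Ω f d := by
  set h : Plane → ℝ := fun x => fderiv ℝ (mollify φ f) x d with hh
  have hsm : ContDiff ℝ ∞ h :=
    ((contDiff_mollify φ hf).fderiv_right (m := ∞) le_rfl).clm_apply contDiff_const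
  obtain ⟨χ, hχ, hχK, hχs, hχ01⟩ := exists_contDiff_cutoff hK φ.rOut_pos
  have hχc : HasCompactSupport χ := hK.cthickening.of_isClosed_subset (isClosed_tsupport _) hχs
  refine ENNReal.le_of_forall_pos_le_add fun η hη _ => ?_
  obtain ⟨κ, hκ, hκη⟩ : ∃ κ : ℝ, 0 < κ ∧ ENNReal.ofReal κ * volume K ≤ η := by
    obtain ⟨κ, hκ, h⟩ := ENNReal.exists_nnreal_pos_mul_lt (hK.measure_lt_top (μ := volume)).ne
      (ENNReal.coe_ne_zero.2 hη.ne')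
    exact ⟨κ, hκ, by simpa using h.le⟩
  have hpos : ∀ x, 0 < √(h x ^ 2 + κ ^ 2) := fun x => Real.sqrt_pos.2 (by positivity)
  set ψ : Plane → ℝ := fun x => χ x * (h x / √(h x ^ 2 + κ ^ 2)) with hψ
  have hψsm : ContDiff ℝ ∞ ψ := by
    refine hχ.mul (hsm.div (((hsm.pow 2).add contDiff_const).sqrt fun x => ?_) fun x => (hpos x).ne')
    positivity
  have hψs : tsupport ψ ⊆ cthickening φ.rOut K := (tsupport_mul_subset_left).trans hχs
  have hψc : HasCompactSupport ψ := hχc.mul_right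
  have hψ1 : ∀ x, |ψ x| ≤ 1 := by
    intro x
    rw [hψ, abs_mul, abs_of_nonneg (hχ01 x).1, abs_div, abs_of_pos (hpos x)]
    refine mul_le_one₀ (hχ01 x).2 (by positivity) ?_
    rw [div_le_one (hpos x), ← Real.sqrt_sq_eq_abs]
    exact Real.sqrt_le_sqrt (by nlinarith)
  have hts : tsupport (mollify φ ψ) ⊆ Ω :=
    (tsupport_mollify_subset φ φ.rOut_pos.le hψs).trans (by rwa [← two_mul])
  have hmc : HasCompactSupport (mollify φ ψ) := by
    exact φ.hasCompactSupport_normed.convolution _ hψc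
  have hmsm := contDiff_mollify φ hψsm.continuous.locallyIntegrable
  have test : ENNReal.ofReal (∫ x, h x * ψ x) ≤ directionalVariation Ω f d := by
    refine le_trans (le_of_eq ?_) (ofReal_integral_le_directionalVariation f d hmsm.neg hmc.neg
      (show tsupport (-mollify φ ψ) ⊆ Ω by rwa [tsupport_neg]) (fun x => by
        simpa using abs_mollify_le_one φ hψ1 x))
    congr 1
    rw [hh, integral_fderiv_mollify_mul φ hf hψsm.continuous hψc, ← integral_neg]
    rw [← integral_indicator hΩ]
    congr 1 with x
    by_cases hx : x ∈ Ω
    · simp [indicator_of_mem hx]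
    · rw [indicator_of_notMem hx]
      simp [fderiv_of_notMem_tsupport (𝕜 := ℝ) fun h => hx (hts h)]
  have hint : Integrable (fun x => h x * ψ x) volume :=
    (hsm.continuous.mul hψsm.continuous).integrable_of_hasCompactSupport hψc.mul_left
  have hψeq : ∀ x, h x * ψ x = χ x * (h x ^ 2 / √(h x ^ 2 + κ ^ 2)) := fun x => by
    rw [hψ]; ring
  have hnn : ∀ x, 0 ≤ h x * ψ x := fun x => by
    rw [hψeq]
    have := (hχ01 x).1
    positivity
  calc ∫⁻ x in K, ‖h x‖ₑ
      ≤ ∫⁻ x in K, (ENNReal.ofReal (h x * ψ x) + ENNReal.ofReal κ) := by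
        refine setLIntegral_mono' hK.measurableSet fun x hx => ?_
        rw [← ENNReal.ofReal_add (hnn x) hκ.le, ← ofReal_norm, Real.norm_eq_abs]
        refine ENNReal.ofReal_le_ofReal ?_
        rw [hψeq, hχK x hx, one_mul]
        exact abs_le_sq_div_sqrt_add (h x) hκ
    _ = (∫⁻ x in K, ENNReal.ofReal (h x * ψ x)) + ENNReal.ofReal κ * volume K := by
        rw [lintegral_add_right _ measurable_const, setLIntegral_const]
    _ ≤ directionalVariation Ω f d + η := by
        refine add_le_add ?_ hκη
        refine (setLIntegral_le_lintegral _ _).trans ?_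
        rwa [← ofReal_integral_eq_lintegral_ofReal hint (Eventually.of_forall hnn)]

theorem fderiv_apply_eq_partialDeriv (ψ : Plane → ℝ) (x d : Plane) :
    fderiv ℝ ψ x d = d.1 * partialDeriv 0 ψ x + d.2 * partialDeriv 1 ψ x := by
  have : d = d.1 • ((1, 0) : Plane) + d.2 • ((0, 1) : Plane) := by ext <;> simp
  conv_lhs => rw [this, map_add, map_smul, map_smul]
  simp [partialDeriv]

/-- The test field `φ p k = d k * ψ / 4` has norm at most one when `|ψ| ≤ 1`, because there are four
entries `p`. -/
theorem directionalVariation_sum_le {Ω : Set Plane} {F : Plane → Fin 2 × Fin 2 → ℝ}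
    (hF : ∀ p, IntegrableOn (fun x => F x p) Ω volume) {d : Plane} (h₁ : d.1 ^ 2 ≤ 1)
    (h₂ : d.2 ^ 2 ≤ 1) :
    directionalVariation Ω (fun x => ∑ p, F x p) d ≤ 4 * totalVariation Ω F := by
  refine iSup₂_le fun ψ ⟨hψ, hc, hs, h1⟩ => ?_
  set c : Fin 2 → ℝ := ![d.1 / 4, d.2 / 4] with hcdef
  set Φ : Plane → Fin 2 × Fin 2 → Fin 2 → ℝ := fun x _ k => c k * ψ x with hΦ
  have hψ2 : ∀ x, ψ x ^ 2 ≤ 1 := fun x => by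
    rw [← sq_abs]; exact pow_le_one₀ (abs_nonneg _) (h1 x)
  have htest : IsTestField Ω Φ := by
    refine ⟨?_, ?_, ?_, fun x => ?_⟩
    · exact contDiff_pi.2 fun _ => contDiff_pi.2 fun _ => contDiff_const.mul hψ
    · exact hc.comp_left (g := fun (y : ℝ) (_ : Fin 2 × Fin 2) (k : Fin 2) => c k * y)
        (by ext; simp)
    · refine (closure_mono fun x hx => ?_).trans hs
      intro h0
      apply hx
      ext p k
      simp [hΦ, h0]
    · simp only [hΦ, hcdef, Finset.sum_const, Finset.card_univ, Fintype.card_prod,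
        Fintype.card_fin, Fin.sum_univ_two, Matrix.cons_val_zero, Matrix.cons_val_one,
        nsmul_eq_mul, Nat.cast_mul, Nat.cast_ofNat]
      nlinarith [hψ2 x, sq_nonneg d.1, sq_nonneg d.2, sq_nonneg (ψ x),
        mul_le_mul h₁ (hψ2 x) (sq_nonneg _) zero_le_one,
        mul_le_mul h₂ (hψ2 x) (sq_nonneg _) zero_le_one]
  have hpd : ∀ k x, partialDeriv k (fun y => c k * ψ y) x = c k * partialDeriv k ψ x := by
    intro k x
    simp only [partialDeriv]
    rw [fderiv_const_mul (hψ.differentiable (by simp) x)]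
    simp
  have hint : ∀ p k, IntegrableOn (fun x => F x p * (c k * partialDeriv k ψ x)) Ω volume := by
    intro p k
    have hcont : Continuous fun x => c k * partialDeriv k ψ x :=
      continuous_const.mul ((hψ.continuous_fderiv (by simp)).clm_apply continuous_const)
    have hcs : HasCompactSupport fun x => c k * partialDeriv k ψ x :=
      ((hc.fderiv ℝ).comp_left (g := fun L : Plane →L[ℝ] ℝ =>
        c k * L ((![(1, 0), (0, 1)] : Fin 2 → Plane) k)) (by simp))
    obtain ⟨M, hM⟩ := hcs.exists_bound_of_continuous hcont
    exact (hF p).mul_bdd (c := M) hcont.aestronglyMeasurable (Eventually.of_forall hM)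
  have key : ∫ x in Ω, (∑ p, F x p) * fderiv ℝ ψ x d =
      4 * ∑ p, ∑ k, ∫ x in Ω, F x p * partialDeriv k (fun y => Φ y p k) x := by
    simp only [hΦ, hpd]
    simp_rw [← integral_finsetSum Finset.univ fun k _ => hint _ k]
    rw [← integral_finsetSum Finset.univ fun p _ =>
      integrable_finsetSum Finset.univ fun k _ => hint p k, ← integral_const_mul]
    congr 1 with x
    rw [fderiv_apply_eq_partialDeriv, Finset.sum_mul, Finset.mul_sum]
    refine Finset.sum_congr rfl fun p _ => ?_
    simp only [Fin.sum_univ_two, hcdef, Matrix.cons_val_zero, Matrix.cons_val_one]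
    ring
  rw [key, ENNReal.ofReal_mul (by norm_num)]
  gcongr
  · simp
  · exact le_iSup₂_of_le (f := fun (φ : Plane → Fin 2 × Fin 2 → Fin 2 → ℝ) (_ : IsTestField Ω φ) =>
      ENNReal.ofReal (∑ i, ∑ k, ∫ x in Ω, F x i * partialDeriv k (fun y => φ y i k) x))
      Φ htest le_rfl

/-! ### Estimates on a single line -/

/-- The distance of `y` to the two wells `θ` and `θ - 1`. -/
noncomputable def wellDist (θ y : ℝ) : ℝ := min |y - θ| |y + (1 - θ)|

theorem wellDist_nonneg (θ y : ℝ) : 0 ≤ wellDist θ y := le_min (abs_nonneg _) (abs_nonneg _)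

theorem continuous_wellDist (θ : ℝ) : Continuous (wellDist θ) := by
  unfold wellDist; fun_prop

theorem wellDist_le_add (θ y z : ℝ) : wellDist θ y ≤ wellDist θ z + |y - z| := by
  unfold wellDist
  rw [← min_add_add_right]
  refine min_le_min ?_ ?_
  · calc |y - θ| = |(z - θ) + (y - z)| := by ring_nf
      _ ≤ _ := abs_add_le _ _
  · calc |y + (1 - θ)| = |(z + (1 - θ)) + (y - z)| := by ring_nf
      _ ≤ _ := abs_add_le _ _

/-- On an interval of length at least `3 / 8`, a function with small oscillation that stays close to
the wells has mean value bounded away from zero; a function with large oscillation has variation at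
least `1 / 4`. -/
theorem well_lower_bound {p p' : ℝ → ℝ} (hp : ∀ t, HasDerivAt p (p' t) t) (hp' : Continuous p')
    {a b θ : ℝ} (hab : 3 / 8 ≤ b - a) (hθ : 0 < θ) (hθ' : θ ≤ 1 / 2) :
    θ / 8 ≤ |∫ t in a..b, p t| + (∫ t in a..b, wellDist θ (p t)) + θ * ∫ t in a..b, |p' t| := by
  have hle : a ≤ b := by linarith
  have hpc : Continuous p := continuous_iff_continuousAt.2 fun t => (hp t).continuousAt
  have hmc : Continuous fun t => wellDist θ (p t) := (continuous_wellDist θ).comp hpc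
  have ip : IntervalIntegrable p volume a b := hpc.intervalIntegrable _ _
  have im : IntervalIntegrable (fun t => wellDist θ (p t)) volume a b := hmc.intervalIntegrable _ _
  have iv : ∀ c d, IntervalIntegrable (fun t => |p' t|) volume c d :=
    fun c d => hp'.abs.intervalIntegrable _ _
  have hV : 0 ≤ ∫ t in a..b, |p' t| := intervalIntegral.integral_nonneg hle fun _ _ => abs_nonneg _
  have hD : 0 ≤ ∫ t in a..b, wellDist θ (p t) :=
    intervalIntegral.integral_nonneg hle fun _ _ => wellDist_nonneg _ _
  have hA := abs_nonneg (∫ t in a..b, p t)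
  rcases le_or_gt (1 / 4) (∫ t in a..b, |p' t|) with hbig | hsmall
  · nlinarith
  have hosc : ∀ x ∈ Icc a b, ∀ y ∈ Icc a b, p x - p y < 1 / 4 := by
    have aux : ∀ x ∈ Icc a b, ∀ y ∈ Icc a b, x ≤ y → |p y - p x| < 1 / 4 := by
      intro x hx y hy hxy
      rw [← intervalIntegral.integral_eq_sub_of_hasDerivAt (fun t _ => hp t)
        (hp'.intervalIntegrable _ _)]
      refine lt_of_le_of_lt (intervalIntegral.abs_integral_le_integral_abs hxy) ?_
      refine lt_of_le_of_lt ?_ hsmall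
      exact intervalIntegral.integral_mono_interval hx.1 hxy hy.2
        (Eventually.of_forall fun _ => abs_nonneg _) (iv a b)
    intro x hx y hy
    rcases le_total x y with h | h
    · have := (abs_lt.1 (aux x hx y hy h)).1; linarith
    · have := (abs_lt.1 (aux y hy x hx h)).2; linarith
  have hconst : ∀ c : ℝ, 0 ≤ c → 3 / 8 * c ≤ ∫ _ in a..b, c := fun c hc => by
    rw [intervalIntegral.integral_const, smul_eq_mul]; nlinarith
  have hθV : 0 ≤ θ * ∫ t in a..b, |p' t| := mul_nonneg hθ.le hV
  by_cases h1 : ∀ t ∈ Icc a b, θ ≤ p t + wellDist θ (p t)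
  · have := intervalIntegral.integral_mono_on hle (intervalIntegrable_const (c := θ))
      (ip.add im) h1
    rw [intervalIntegral.integral_add ip im] at this
    have h2 := hconst θ hθ.le
    have h3 := le_abs_self (∫ t in a..b, p t)
    linarith
  by_cases h2 : ∀ t ∈ Icc a b, θ ≤ -p t + wellDist θ (p t)
  · have := intervalIntegral.integral_mono_on hle (intervalIntegrable_const (c := θ))
      (ip.neg.add im) h2
    rw [intervalIntegral.integral_add ip.neg im] at this
    simp only [Pi.neg_apply, intervalIntegral.integral_neg] at this
    have h2 := hconst θ hθ.le
    have h3 := neg_le_abs (∫ t in a..b, p t)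
    linarith
  push Not at h1 h2
  obtain ⟨x, hx, hxw⟩ := h1
  obtain ⟨y, hy, hyw⟩ := h2
  have hpx : p x < θ - 1 / 2 := by
    by_contra! hcon
    have : wellDist θ (p x) = |p x - θ| := by
      refine min_eq_left ?_
      rw [abs_le]
      constructor <;> linarith [le_abs_self (p x + (1 - θ))]
    rw [this] at hxw
    linarith [neg_le_abs (p x - θ)]
  have hpy : θ - 1 / 2 < p y := by
    by_contra! hcon
    have : wellDist θ (p y) = |p y + (1 - θ)| := by
      refine min_eq_right ?_
      rw [abs_le]
      constructor <;> linarith [neg_le_abs (p y - θ)]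
    rw [this] at hyw
    linarith [le_abs_self (p y + (1 - θ))]
  have h3 : ∀ t ∈ Icc a b, θ / 2 ≤ wellDist θ (p t) := by
    intro t ht
    have e1 := hosc t ht x hx
    have e2 := hosc y hy t ht
    refine le_min ?_ ?_
    · linarith [neg_le_abs (p t - θ)]
    · linarith [le_abs_self (p t + (1 - θ))]
  have := intervalIntegral.integral_mono_on hle (intervalIntegrable_const (c := θ / 2)) im h3
  have h4 := hconst (θ / 2) (by linarith)
  linarith

theorem lintegral_Ioo_eq_ofReal {h : ℝ → ℝ} (hc : Continuous h) (h0 : ∀ t, 0 ≤ h t) {a b : ℝ}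
    (hab : a ≤ b) : ∫⁻ t in Ioo a b, ENNReal.ofReal (h t) = ENNReal.ofReal (∫ t in a..b, h t) := by
  rw [intervalIntegral.integral_of_le hab, integral_Ioc_eq_integral_Ioo,
    ofReal_integral_eq_lintegral_ofReal]
  · exact (hc.integrableOn_Icc (a := a) (b := b)).mono_set Ioo_subset_Icc_self
  · exact Eventually.of_forall h0

/-- The previous bound with extended nonnegative integrals. -/
theorem well_lower_bound_lintegral {p p' : ℝ → ℝ} (hp : ∀ t, HasDerivAt p (p' t) t)
    (hp' : Continuous p') {a b θ : ℝ} (hab : 3 / 8 ≤ b - a) (hθ : 0 < θ) (hθ' : θ ≤ 1 / 2) :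
    ENNReal.ofReal (θ / 8) ≤ ‖∫ t in a..b, p t‖ₑ +
      (∫⁻ t in Ioo a b, ENNReal.ofReal (wellDist θ (p t))) +
      ENNReal.ofReal θ * ∫⁻ t in Ioo a b, ‖p' t‖ₑ := by
  have hle : a ≤ b := by linarith
  have hpc : Continuous p := continuous_iff_continuousAt.2 fun t => (hp t).continuousAt
  have hV : 0 ≤ ∫ t in a..b, |p' t| := intervalIntegral.integral_nonneg hle fun _ _ => abs_nonneg _
  have hD : 0 ≤ ∫ t in a..b, wellDist θ (p t) :=
    intervalIntegral.integral_nonneg hle fun _ _ => wellDist_nonneg _ _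
  have hmc : Continuous fun t => wellDist θ (p t) := (continuous_wellDist θ).comp hpc
  simp_rw [← ofReal_norm (p' _), Real.norm_eq_abs]
  rw [lintegral_Ioo_eq_ofReal hmc (fun _ => wellDist_nonneg _ _) hle,
    lintegral_Ioo_eq_ofReal hp'.abs (fun _ => abs_nonneg _) hle, ← ofReal_norm, Real.norm_eq_abs,
    ← ENNReal.ofReal_mul hθ.le, ← ENNReal.ofReal_add (abs_nonneg _) hD,
    ← ENNReal.ofReal_add (add_nonneg (abs_nonneg _) hD) (mul_nonneg hθ.le hV)]
  exact ENNReal.ofReal_le_ofReal (well_lower_bound hp hp' hab hθ hθ')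

theorem hasDerivAt_comp_line {W : Plane → ℝ} (hW : ContDiff ℝ 1 W) {γ₁ γ₂ : ℝ → ℝ} {d₁ d₂ t : ℝ}
    (h₁ : HasDerivAt γ₁ d₁ t) (h₂ : HasDerivAt γ₂ d₂ t) :
    HasDerivAt (fun t => W (γ₁ t, γ₂ t)) (fderiv ℝ W (γ₁ t, γ₂ t) (d₁, d₂)) t :=
  ((hW.differentiable one_ne_zero _).hasFDerivAt).comp_hasDerivAt t (h₁.prodMk h₂)

/-- The increments of `W` along the closed triangle with vertices `(-(s+1), -(2s+1))`,
`(2s+2, s+2)`, `(-(s+1), s+2)` add up to zero; the part of the hypotenuse over `(a, b)` is estimated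
by the rest. The legs are parametrised by the same interval as the hypotenuse. -/
theorem enorm_integral_diagonal_le {W : Plane → ℝ} (hW : ContDiff ℝ 1 W) {s a b : ℝ}
    (ha : -(2 * s + 1) ≤ a) (hab : a ≤ b) (hb : b ≤ s + 2) :
    ‖∫ t in a..b, fderiv ℝ W (s + t, t) (1, 1)‖ₑ ≤
      (∫⁻ t in Ioo (-(2 * s + 1)) (s + 2) \ Ioo a b, ‖fderiv ℝ W (s + t, t) (1, 1)‖ₑ) +
      (∫⁻ t in Ioo (-(2 * s + 1)) (s + 2), ‖partialDeriv 0 W (s + t, s + 2)‖ₑ) +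
      ∫⁻ t in Ioo (-(2 * s + 1)) (s + 2), ‖partialDeriv 1 W (-(s + 1), t)‖ₑ := by
  set A := -(2 * s + 1) with hA
  set B := s + 2 with hB
  have hAB : A ≤ B := ha.trans (hab.trans hb)
  set F : ℝ → ℝ := fun t => fderiv ℝ W (s + t, t) (1, 1) with hF
  set P : ℝ → ℝ := fun t => partialDeriv 0 W (s + t, B) with hP
  set Q : ℝ → ℝ := fun t => partialDeriv 1 W (-(s + 1), t) with hQ
  have hdc := hW.continuous_fderiv one_ne_zero
  have hFc : Continuous F := (hdc.comp (by fun_prop)).clm_apply continuous_const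
  have hPc : Continuous P := (hdc.comp (by fun_prop : Continuous fun t : ℝ => (s + t, B))).clm_apply
    continuous_const
  have hQc : Continuous Q :=
    (hdc.comp (by fun_prop : Continuous fun t : ℝ => (-(s + 1), t))).clm_apply continuous_const
  have hder : ∀ t, HasDerivAt
      (fun t => W (s + t, t) - W (s + t, B) - W (-(s + 1), t)) (F t - P t - Q t) t := by
    intro t
    have h1 : HasDerivAt (fun t : ℝ => s + t) 1 t := (hasDerivAt_id t).const_add s
    exact ((hasDerivAt_comp_line hW h1 (hasDerivAt_id t)).sub
      (hasDerivAt_comp_line hW h1 (hasDerivAt_const t B))).sub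
      (hasDerivAt_comp_line hW (hasDerivAt_const t (-(s + 1))) (hasDerivAt_id t))
  have hloop : ∫ t in A..B, (F t - P t - Q t) = 0 := by
    rw [intervalIntegral.integral_eq_sub_of_hasDerivAt (fun t _ => hder t)
      (((hFc.sub hPc).sub hQc).intervalIntegrable _ _)]
    have e1 : s + A = -(s + 1) := by rw [hA]; ring
    simp only [e1]
    ring
  have iF : ∀ c d, IntervalIntegrable F volume c d := fun c d => hFc.intervalIntegrable c d
  have hsplit : ∫ t in a..b, F t =
      (∫ t in A..B, P t) + (∫ t in A..B, Q t) - ∫ t in Ioo A B \ Ioo a b, F t := by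
    rw [intervalIntegral.integral_sub ((iF _ _).sub (hPc.intervalIntegrable _ _))
      (hQc.intervalIntegrable _ _), intervalIntegral.integral_sub (iF _ _)
      (hPc.intervalIntegrable _ _)] at hloop
    have hdiff : ∫ t in Ioo A B \ Ioo a b, F t = (∫ t in A..B, F t) - ∫ t in a..b, F t := by
      rw [setIntegral_sdiff measurableSet_Ioo
        ((hFc.integrableOn_Icc (a := A) (b := B)).mono_set Ioo_subset_Icc_self)
        (Ioo_subset_Ioo ha hb), intervalIntegral.integral_of_le hAB,
        intervalIntegral.integral_of_le hab, integral_Ioc_eq_integral_Ioo,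
        integral_Ioc_eq_integral_Ioo]
    linarith
  have hint : ∀ h : ℝ → ℝ, ‖∫ t in A..B, h t‖ₑ ≤ ∫⁻ t in Ioo A B, ‖h t‖ₑ := by
    intro h
    rw [intervalIntegral.integral_of_le hAB, integral_Ioc_eq_integral_Ioo]
    exact enorm_integral_le_lintegral_enorm _
  rw [hsplit]
  calc _ ≤ ‖(∫ t in A..B, P t)‖ₑ + ‖∫ t in A..B, Q t‖ₑ + ‖∫ t in Ioo A B \ Ioo a b, F t‖ₑ :=
        enorm_sub_le.trans (by gcongr; exact enorm_add_le _ _)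
    _ ≤ (∫⁻ t in Ioo A B, ‖P t‖ₑ) + (∫⁻ t in Ioo A B, ‖Q t‖ₑ) +
        ∫⁻ t in Ioo A B \ Ioo a b, ‖F t‖ₑ := by
        gcongr
        · exact hint P
        · exact hint Q
        · exact enorm_integral_le_lintegral_enorm _
    _ = _ := by ring

/-! ### Smooth approximation -/

/-- The points of the nucleus at distance at least `δ` from its boundary. -/
def nucleusCore (L δ : ℝ) : Set Plane := Icc δ (2 * L - δ) ×ˢ Icc δ (1 - δ)

theorem isCompact_nucleusCore (L δ : ℝ) : IsCompact (nucleusCore L δ) :=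
  isCompact_Icc.prod isCompact_Icc

theorem measurableSet_nucleus (L : ℝ) : MeasurableSet (nucleus L) :=
  measurableSet_Ioo.prod measurableSet_Ioo

theorem cthickening_nucleusCore_subset {L δ r : ℝ} (hr : 0 ≤ r) (h : r < δ) :
    cthickening r (nucleusCore L δ) ⊆ nucleus L := by
  rw [(isCompact_nucleusCore L δ).cthickening_eq_biUnion_closedBall hr]
  intro y hy
  simp only [mem_iUnion, mem_closedBall, exists_prop] at hy
  obtain ⟨x, ⟨⟨h1, h2⟩, h3, h4⟩, hxy⟩ := hy
  rw [Prod.dist_eq, max_le_iff, Real.dist_eq, Real.dist_eq, abs_le, abs_le] at hxy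
  obtain ⟨⟨h5, h6⟩, h7, h8⟩ := hxy
  refine ⟨⟨?_, ?_⟩, ?_, ?_⟩ <;> linarith

theorem exists_lintegral_diff_nucleusCore_le (L : ℝ) {h : Plane → ℝ≥0∞}
    (hh : ∫⁻ x in nucleus L, h x ≠ ⊤) {η : ℝ≥0∞} (hη : 0 < η) :
    ∃ δ : ℝ, 0 < δ ∧ δ ≤ 1 / 16 ∧ ∫⁻ x in nucleus L \ nucleusCore L δ, h x ≤ η := by
  set s : ℕ → Set Plane := fun n => (nucleusCore L (1 / (n + 16 : ℝ)))ᶜ with hs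
  have hm : ∀ n, MeasurableSet (s n) := fun n =>
    (isCompact_nucleusCore L _).measurableSet.compl
  have hanti : Antitone s := by
    intro m n hmn
    refine compl_subset_compl.2 ?_
    have : 1 / (n + 16 : ℝ) ≤ 1 / (m + 16 : ℝ) := by gcongr
    exact prod_mono (Icc_subset_Icc this (by linarith)) (Icc_subset_Icc this (by linarith))
  have hfin : volume.restrict (nucleus L) (s 0) ≠ ⊤ := by
    refine ne_top_of_le_ne_top ?_ (measure_mono (subset_univ _))
    rw [Measure.restrict_apply_univ]
    have : nucleus L ⊆ Icc 0 (2 * L) ×ˢ Icc 0 1 :=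
      prod_mono Ioo_subset_Icc_self Ioo_subset_Icc_self
    exact ne_top_of_le_ne_top (isCompact_Icc.prod isCompact_Icc).measure_lt_top.ne
      (measure_mono this)
  have hlim := tendsto_measure_iInter_atTop (μ := volume.restrict (nucleus L))
    (fun n => (hm n).nullMeasurableSet) hanti ⟨0, hfin⟩
  have hempty : volume.restrict (nucleus L) (⋂ n, s n) = 0 := by
    rw [Measure.restrict_apply (MeasurableSet.iInter hm)]
    convert measure_empty (μ := volume)
    rw [eq_empty_iff_forall_notMem]
    rintro x ⟨hx, ⟨h1, h2⟩, h3, h4⟩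
    obtain ⟨n, hn⟩ := exists_nat_one_div_lt
      (lt_min (lt_min h1 (sub_pos.2 h2)) (lt_min h3 (sub_pos.2 h4)))
    have hn' : 1 / (n + 16 : ℝ) < min (min x.1 (2 * L - x.1)) (min x.2 (1 - x.2)) :=
      lt_of_le_of_lt (by gcongr; norm_num) hn
    simp only [lt_min_iff] at hn'
    refine mem_iInter.1 hx n ⟨⟨?_, ?_⟩, ?_, ?_⟩ <;> linarith [hn'.1.1, hn'.1.2, hn'.2.1, hn'.2.2]
  rw [hempty] at hlim
  have h0 := tendsto_setLIntegral_zero hh hlim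
  obtain ⟨n, hn⟩ := (h0.eventually (gt_mem_nhds hη)).exists
  refine ⟨1 / (n + 16 : ℝ), by positivity, ?_, ?_⟩
  · gcongr
    linarith [(n.cast_nonneg : (0 : ℝ) ≤ n)]
  · refine le_trans (le_of_eq ?_) hn.le
    rw [Measure.restrict_restrict (hm n)]
    congr 2
    ext x
    simp [hs, and_comm]

/-- A smooth function `W` whose gradient is close in `L¹` to `(g₀, g₁)`, and such that the derivative
`∂₁W + ∂₂W` of `W` in direction `(1, 1)` has variation at most `T` inside the nucleus. -/
structure IsSmoothApprox (L δ : ℝ) (η T : ℝ≥0∞) (g₀ g₁ W : Plane → ℝ) : Prop where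
  contDiff : ContDiff ℝ ∞ W
  fst : ∫⁻ x in closedBall 0 (10 * L + 10), ‖partialDeriv 0 W x - g₀ x‖ₑ ≤ η
  snd : ∫⁻ x in closedBall 0 (10 * L + 10), ‖partialDeriv 1 W x - g₁ x‖ₑ ≤ η
  diag : ∫⁻ x in closedBall 0 (10 * L + 10), ‖fderiv ℝ W x (1, 1) - (g₀ x + g₁ x)‖ₑ ≤ η
  var_diag : ∫⁻ x in nucleusCore L δ, ‖fderiv ℝ (fun y => fderiv ℝ W y (1, 1)) x (1, 1)‖ₑ ≤ T
  var_fst : ∫⁻ x in nucleusCore L δ, ‖fderiv ℝ (fun y => fderiv ℝ W y (1, 1)) x (1, 0)‖ₑ ≤ T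

/-- Mollifications at a small scale are smooth approximations. -/
theorem exists_isSmoothApprox {L δ : ℝ} {η T : ℝ≥0∞} {w g₀ g₁ : Plane → ℝ}
    (hw : LocallyIntegrable w volume) (hg₀ : LocallyIntegrable g₀ volume)
    (hg₁ : LocallyIntegrable g₁ volume)
    (h₀ : ∀ ψ : Plane → ℝ, ContDiff ℝ ∞ ψ → HasCompactSupport ψ →
      ∫ x, w x * partialDeriv 0 ψ x = -∫ x, g₀ x * ψ x)
    (h₁ : ∀ ψ : Plane → ℝ, ContDiff ℝ ∞ ψ → HasCompactSupport ψ →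
      ∫ x, w x * partialDeriv 1 ψ x = -∫ x, g₁ x * ψ x)
    (hT : directionalVariation (nucleus L) (fun x => g₀ x + g₁ x) (1, 1) ≤ T)
    (hT' : directionalVariation (nucleus L) (fun x => g₀ x + g₁ x) (1, 0) ≤ T)
    (hδ : 0 < δ) (hη : η ≠ 0) : ∃ W, IsSmoothApprox L δ η T g₀ g₁ W := by
  have hf : LocallyIntegrable (fun x => g₀ x + g₁ x) volume := hg₀.add hg₁
  obtain ⟨r₀, hr₀, H₀⟩ := exists_lintegral_mollify_sub_le hg₀ (10 * L + 10) hη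
  obtain ⟨r₁, hr₁, H₁⟩ := exists_lintegral_mollify_sub_le hg₁ (10 * L + 10) hη
  obtain ⟨r₂, hr₂, H₂⟩ := exists_lintegral_mollify_sub_le hf (10 * L + 10) hη
  set r := min (min r₀ r₁) (min r₂ (δ / 2)) with hr
  have hrpos : 0 < r := lt_min (lt_min hr₀ hr₁) (lt_min hr₂ (by linarith))
  let φ : ContDiffBump (0 : Plane) := ⟨r / 4, r / 2, by positivity, by linarith⟩
  have hφ : φ.rOut = r / 2 := rfl
  have l₀ : r ≤ r₀ := (min_le_left _ _).trans (min_le_left _ _)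
  have l₁ : r ≤ r₁ := (min_le_left _ _).trans (min_le_right _ _)
  have l₂ : r ≤ r₂ := (min_le_right _ _).trans (min_le_left _ _)
  have l₃ : r ≤ δ / 2 := (min_le_right _ _).trans (min_le_right _ _)
  have e₀ : ∀ x, partialDeriv 0 (mollify φ w) x = mollify φ g₀ x := partialDeriv_mollify φ hw h₀
  have e₁ : ∀ x, partialDeriv 1 (mollify φ w) x = mollify φ g₁ x := partialDeriv_mollify φ hw h₁
  have e₂ : ∀ x, fderiv ℝ (mollify φ w) x (1, 1) = mollify φ (fun y => g₀ y + g₁ y) x := by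
    intro x
    have i : ∀ {k : Plane → ℝ}, LocallyIntegrable k volume →
        Integrable (fun y => φ.normed volume (x - y) * k y) volume := fun hk => by
      have := (φ.hasCompactSupport_normed (μ := (volume : Measure Plane))).convolutionExists_left
        (ContinuousLinearMap.lsmul ℝ ℝ) φ.continuous_normed hk x
      simpa using this.integrable_swap
    rw [fderiv_apply_eq_partialDeriv, e₀, e₁, one_mul, one_mul]
    simp only [mollify_apply]
    rw [← integral_add (i hg₀) (i hg₁)]
    congr 1 with y
    ring
  have hsub : cthickening (2 * φ.rOut) (nucleusCore L δ) ⊆ nucleus L :=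
    cthickening_nucleusCore_subset (by positivity) (by rw [hφ]; linarith)
  refine ⟨mollify φ w, contDiff_mollify φ hw, ?_, ?_, ?_, ?_, ?_⟩
  · simp_rw [e₀]; exact H₀ φ (by rw [hφ]; linarith)
  · simp_rw [e₁]; exact H₁ φ (by rw [hφ]; linarith)
  · simp_rw [e₂]; exact H₂ φ (by rw [hφ]; linarith)
  · simp_rw [e₂]
    exact (lintegral_fderiv_mollify_le φ hf _ (measurableSet_nucleus L)
      (isCompact_nucleusCore L δ) hsub).trans hT
  · simp_rw [e₂]
    exact (lintegral_fderiv_mollify_le φ hf _ (measurableSet_nucleus L)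
      (isCompact_nucleusCore L δ) hsub).trans hT'

/-! ### Weighted integrals over families of lines -/

/-- The parameters `(s, t)` of the triangular loops: `s` selects the loop, `t` is the common parameter
of its three sides. -/
def loopParam (L : ℝ) : Set (ℝ × ℝ) :=
  {p | p.1 ∈ Ioo (-1 / 2) (2 * L - 1) ∧ p.2 ∈ Ioo (-(2 * p.1 + 1)) (p.1 + 2)}

/-- The parameters for which the hypotenuse `(s + t, t)` lies in the nucleus, shrunk by `δ`. -/
def crossParam (L δ : ℝ) : Set (ℝ × ℝ) :=
  {p | p.1 ∈ Ioo (-1 / 2) (2 * L - 1) ∧ p.2 ∈ Ioo (max 0 (-p.1) + δ) (1 - δ)}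

theorem measurableSet_loopParam (L : ℝ) : MeasurableSet (loopParam L) := by
  unfold loopParam
  simp only [mem_Ioo]
  measurability

theorem measurableSet_crossParam (L δ : ℝ) : MeasurableSet (crossParam L δ) := by
  unfold crossParam
  simp only [mem_Ioo]
  refine MeasurableSet.inter (MeasurableSet.inter ?_ ?_) (MeasurableSet.inter ?_ ?_)
  · exact measurableSet_lt measurable_const measurable_fst
  · exact measurableSet_lt measurable_fst measurable_const
  · exact measurableSet_lt ((measurable_const.max measurable_fst.neg).add_const _) measurable_snd
  · exact measurableSet_lt measurable_snd measurable_const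

/-- The hypotenuses of the triangular loops; `t` is the second coordinate. -/
def diagMap (p : ℝ × ℝ) : Plane := (p.1 + p.2, p.2)

/-- The horizontal legs, parametrised by the hypotenuse point with the same first coordinate. -/
def topMap (p : ℝ × ℝ) : Plane := (p.1 + p.2, p.1 + 2)

/-- The vertical legs, parametrised by the second coordinate. -/
def leftMap (p : ℝ × ℝ) : Plane := (-(p.1 + 1), p.2)

theorem measurePreserving_diagMap : MeasurePreserving diagMap volume volume :=
  measurePreserving_add_prod (volume : Measure ℝ) (volume : Measure ℝ)

theorem measurePreserving_topMap : MeasurePreserving topMap volume volume := by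
  have h1 := measurePreserving_prod_add (volume : Measure ℝ) (volume : Measure ℝ)
  have h2 := (MeasurePreserving.id (volume : Measure ℝ)).prod
    (measurePreserving_add_right (volume : Measure ℝ) 2)
  exact h2.comp ((Measure.measurePreserving_swap (μ := (volume : Measure ℝ))
    (ν := (volume : Measure ℝ))).comp h1)

theorem measurePreserving_leftMap : MeasurePreserving leftMap volume volume := by
  have h1 : MeasurePreserving (fun s : ℝ => -(s + 1)) volume volume :=
    (Measure.measurePreserving_neg (volume : Measure ℝ)).comp
      (measurePreserving_add_right (volume : Measure ℝ) 1)
  exact h1.prod (MeasurePreserving.id (volume : Measure ℝ))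

theorem setLIntegral_comp_le {Ψ : ℝ × ℝ → Plane} (hΨ : MeasurePreserving Ψ volume volume)
    {T : Set (ℝ × ℝ)} {U : Set Plane} (hU : MeasurableSet U)
    (hTU : MapsTo Ψ T U) {h : Plane → ℝ≥0∞} (hh : AEMeasurable h volume) :
    ∫⁻ p in T, h (Ψ p) ≤ ∫⁻ x in U, h x := by
  calc ∫⁻ p in T, h (Ψ p) ≤ ∫⁻ p in Ψ ⁻¹' U, h (Ψ p) := lintegral_mono_set hTU
    _ = ∫⁻ p, U.indicator h (Ψ p) := by
      rw [← lintegral_indicator (hΨ.measurable hU)]; rfl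
    _ = ∫⁻ x in U, h x := by
      rw [← lintegral_map' (f := U.indicator h) (by rw [hΨ.map_eq]; exact hh.indicator hU)
        hΨ.measurable.aemeasurable, hΨ.map_eq, lintegral_indicator hU]

/-- The Cauchy-Schwarz inequality. -/
theorem sq_lintegral_mul_le {α : Type*} [MeasurableSpace α] {μ : Measure α} {h k : α → ℝ≥0∞}
    (hh : AEMeasurable h μ) (hk : AEMeasurable k μ) :
    (∫⁻ x, h x * k x ∂μ) ^ 2 ≤ (∫⁻ x, h x ^ 2 ∂μ) * ∫⁻ x, k x ^ 2 ∂μ := by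
  have H := ENNReal.lintegral_mul_le_Lp_mul_Lq μ Real.HolderConjugate.two_two hh hk
  calc (∫⁻ x, h x * k x ∂μ) ^ 2
      ≤ ((∫⁻ x, h x ^ (2 : ℝ) ∂μ) ^ (1 / 2 : ℝ) * (∫⁻ x, k x ^ (2 : ℝ) ∂μ) ^ (1 / 2 : ℝ)) ^ 2 := by
        gcongr; exact H
    _ = _ := by
        rw [mul_pow, ← ENNReal.rpow_natCast, ← ENNReal.rpow_natCast, ← ENNReal.rpow_mul,
          ← ENNReal.rpow_mul]
        norm_num

theorem measurable_setLIntegral_section {T : Set (ℝ × ℝ)} (hT : MeasurableSet T)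
    {h : ℝ × ℝ → ℝ≥0∞} (hh : Measurable h) :
    Measurable fun s => ∫⁻ t in Prod.mk s ⁻¹' T, h (s, t) := by
  have : ∀ s, ∫⁻ t in Prod.mk s ⁻¹' T, h (s, t) = ∫⁻ t, T.indicator h (s, t) := fun s => by
    rw [← lintegral_indicator (measurable_prodMk_left hT)]; rfl
  simp_rw [this]
  exact (hh.indicator hT).lintegral_prod_right'

theorem setLIntegral_weight_mul {T : Set (ℝ × ℝ)} (hT : MeasurableSet T) {ρ : ℝ → ℝ≥0∞}
    (hρ : Measurable ρ) {h : ℝ × ℝ → ℝ≥0∞} (hh : Measurable h) :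
    ∫⁻ p in T, ρ p.1 * h p = ∫⁻ s, ρ s * ∫⁻ t in Prod.mk s ⁻¹' T, h (s, t) := by
  have hm : Measurable (T.indicator fun p => ρ p.1 * h p) :=
    ((hρ.comp measurable_fst).mul hh).indicator hT
  rw [← lintegral_indicator hT, Measure.volume_eq_prod, lintegral_prod _ hm.aemeasurable]
  refine lintegral_congr fun s => ?_
  have hs : Measurable fun t => h (s, t) := hh.comp measurable_prodMk_left
  rw [← lintegral_const_mul _ hs, ← lintegral_indicator (measurable_prodMk_left hT)]
  rfl

section WeightedBounds

variable {L δ θ : ℝ} {η T : ℝ≥0∞} {g₀ g₁ W : Plane → ℝ} {ρ : ℝ → ℝ≥0∞}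

theorem loopParam_bounds {p : ℝ × ℝ} (hp : p ∈ loopParam L) :
    |p.1| ≤ 2 * L + 1 ∧ |p.2| ≤ 4 * L + 1 := by
  obtain ⟨⟨h1, h2⟩, h3, h4⟩ := hp
  constructor <;> rw [abs_le] <;> constructor <;> linarith

theorem mapsTo_closedBall :
    MapsTo diagMap (loopParam L) (closedBall 0 (10 * L + 10)) ∧
    MapsTo topMap (loopParam L) (closedBall 0 (10 * L + 10)) ∧
    MapsTo leftMap (loopParam L) (closedBall 0 (10 * L + 10)) := by
  refine ⟨fun p hp => ?_, fun p hp => ?_, fun p hp => ?_⟩ <;>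
  · obtain ⟨h1, h2⟩ := loopParam_bounds hp
    rw [abs_le] at h1 h2
    simp only [diagMap, topMap, leftMap, mem_closedBall_zero_iff, Prod.norm_def, Real.norm_eq_abs,
      max_le_iff, abs_le]
    refine ⟨⟨?_, ?_⟩, ?_, ?_⟩ <;> linarith [h1.1, h1.2, h2.1, h2.2]

theorem crossParam_subset_loopParam (hδ : 0 ≤ δ) : crossParam L δ ⊆ loopParam L := by
  rintro p ⟨⟨h1, h2⟩, h3, h4⟩
  refine ⟨⟨h1, h2⟩, ?_, ?_⟩ <;> linarith [le_max_left 0 (-p.1), le_max_right 0 (-p.1)]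

theorem mapsTo_diagMap_core :
    MapsTo diagMap (crossParam L δ) (nucleusCore L δ) := by
  rintro p ⟨⟨h1, h2⟩, h3, h4⟩
  have := le_max_left 0 (-p.1)
  have := le_max_right 0 (-p.1)
  refine ⟨⟨?_, ?_⟩, ?_, ?_⟩ <;> simp only [diagMap] <;> linarith

theorem mapsTo_diagMap_nucleus : MapsTo diagMap (crossParam L 0) (nucleus L) := by
  rintro p ⟨⟨h1, h2⟩, h3, h4⟩
  have := le_max_left 0 (-p.1)
  have := le_max_right 0 (-p.1)
  refine ⟨⟨?_, ?_⟩, ?_, ?_⟩ <;> simp only [diagMap] <;> linarith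

theorem mapsTo_diagMap_compl :
    MapsTo diagMap (loopParam L \ crossParam L 0) (nucleus L)ᶜ := by
  rintro p ⟨⟨h1, h2⟩, h3⟩ ⟨⟨h4, h5⟩, h6, h7⟩
  refine h3 ⟨h1, ?_, ?_⟩
  · simp only [diagMap] at h4 h6
    rw [add_zero, max_lt_iff]
    constructor <;> linarith
  · simp only [diagMap] at h7
    linarith

theorem mapsTo_diagMap_layer (hδ : 0 < δ) :
    MapsTo diagMap (crossParam L 0 \ crossParam L δ) (nucleus L \ nucleusCore L (2 * δ)) := by
  rintro p ⟨hp, h3⟩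
  refine ⟨mapsTo_diagMap_nucleus hp, ?_⟩
  rintro ⟨⟨h4, h5⟩, h6, h7⟩
  simp only [diagMap] at h4 h5 h6 h7
  refine h3 ⟨hp.1, ?_, by linarith⟩
  rw [← max_add_add_right, max_lt_iff]
  constructor <;> linarith

theorem mapsTo_topMap_compl : MapsTo topMap (loopParam L) (nucleus L)ᶜ := by
  rintro p ⟨⟨h1, h2⟩, h3⟩ ⟨⟨h4, h5⟩, h6, h7⟩
  simp only [topMap] at h7
  linarith

theorem mapsTo_leftMap_compl : MapsTo leftMap (loopParam L) (nucleus L)ᶜ := by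
  rintro p ⟨⟨h1, h2⟩, h3⟩ ⟨⟨h4, h5⟩, h6, h7⟩
  simp only [leftMap] at h4
  linarith

theorem measurable_weight_section {S : Set (ℝ × ℝ)} (hS : MeasurableSet S) (hρ : Measurable ρ)
    {h : ℝ × ℝ → ℝ≥0∞} (hh : Measurable h) :
    Measurable fun s => ρ s * ∫⁻ t in Prod.mk s ⁻¹' S, h (s, t) :=
  hρ.mul (measurable_setLIntegral_section hS hh)

/-- Replacing an integrand by a nearby one in a weighted integral over a family of lines. -/
theorem setLIntegral_weight_comp_le {Ψ : ℝ × ℝ → Plane} (hΨ : MeasurePreserving Ψ volume volume)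
    {S : Set (ℝ × ℝ)} {B : Set Plane} (hB : MeasurableSet B) (hSB : MapsTo Ψ S B)
    (hρ : ∀ s, ρ s ≤ 1) {h k e : Plane → ℝ≥0∞} (he : AEMeasurable e volume)
    (hle : ∀ x, h x ≤ k x + e x) :
    ∫⁻ p in S, ρ p.1 * h (Ψ p) ≤ (∫⁻ p in S, ρ p.1 * k (Ψ p)) + ∫⁻ x in B, e x := by
  have hem : AEMeasurable (fun p => e (Ψ p)) (volume.restrict S) :=
    (he.comp_quasiMeasurePreserving hΨ.quasiMeasurePreserving).restrict
  calc ∫⁻ p in S, ρ p.1 * h (Ψ p)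
      ≤ ∫⁻ p in S, (ρ p.1 * k (Ψ p) + e (Ψ p)) := by
        refine lintegral_mono fun p => ?_
        calc ρ p.1 * h (Ψ p) ≤ ρ p.1 * (k (Ψ p) + e (Ψ p)) := by gcongr; exact hle _
          _ ≤ ρ p.1 * k (Ψ p) + 1 * e (Ψ p) := by rw [mul_add]; gcongr; exact hρ _
          _ = _ := by rw [one_mul]
    _ = (∫⁻ p in S, ρ p.1 * k (Ψ p)) + ∫⁻ p in S, e (Ψ p) := lintegral_add_right' _ hem
    _ ≤ _ := add_le_add le_rfl (setLIntegral_comp_le hΨ hB hSB he)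

theorem enorm_le_add_enorm_sub (a b : ℝ) : ‖a‖ₑ ≤ ‖b‖ₑ + ‖a - b‖ₑ := by
  calc ‖a‖ₑ = ‖b + (a - b)‖ₑ := by ring_nf
    _ ≤ _ := enorm_add_le _ _

theorem preimage_loopParam {s : ℝ} (hs : s ∈ Ioo (-1 / 2) (2 * L - 1)) :
    Prod.mk s ⁻¹' loopParam L = Ioo (-(2 * s + 1)) (s + 2) := by
  ext t
  exact and_iff_right hs

theorem preimage_crossParam {s : ℝ} (hs : s ∈ Ioo (-1 / 2) (2 * L - 1)) :
    Prod.mk s ⁻¹' crossParam L δ = Ioo (max 0 (-s) + δ) (1 - δ) := by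
  ext t
  exact and_iff_right hs

/-- The contribution of the exterior to the loops, for the weak gradient. -/
noncomputable def loopExterior (L : ℝ) (g₀ g₁ : Plane → ℝ) (ρ : ℝ → ℝ≥0∞) : ℝ≥0∞ :=
  (∫⁻ p in loopParam L \ crossParam L 0, ρ p.1 * ‖g₀ (diagMap p) + g₁ (diagMap p)‖ₑ) +
    (∫⁻ p in loopParam L, ρ p.1 * ‖g₀ (topMap p)‖ₑ) +
    ∫⁻ p in loopParam L, ρ p.1 * ‖g₁ (leftMap p)‖ₑ

/-- The integrals over the shrunk crossings are bounded by the exterior parts of the loops. The error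
consists of three approximation errors and the boundary layer of the nucleus. -/
theorem lintegral_weight_diagonal_le (hW : IsSmoothApprox L δ η T g₀ g₁ W) (hδ : 0 < δ)
    (hδ' : δ ≤ 1 / 16) (hρ : Measurable ρ) (hρ1 : ∀ s, ρ s ≤ 1)
    (hρS : ∀ s ∉ Ioo (-1 / 2) (2 * L - 1), ρ s = 0)
    (hg₀ : AEStronglyMeasurable g₀ volume) (hg₁ : AEStronglyMeasurable g₁ volume)
    (hlayer : ∫⁻ x in nucleus L \ nucleusCore L (2 * δ), ‖g₀ x + g₁ x‖ₑ ≤ η) :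
    ∫⁻ s, ρ s * ‖∫ t in (max 0 (-s) + δ)..(1 - δ), fderiv ℝ W (s + t, t) (1, 1)‖ₑ ≤
      loopExterior L g₀ g₁ ρ + 4 * η := by
  have hW1 : ContDiff ℝ 1 W := hW.contDiff.of_le (by simp)
  have hdc := hW1.continuous_fderiv one_ne_zero
  have hF : Continuous fun x => fderiv ℝ W x (1, 1) := hdc.clm_apply continuous_const
  have hP : Continuous fun x => partialDeriv 0 W x := hdc.clm_apply continuous_const
  have hQ : Continuous fun x => partialDeriv 1 W x := hdc.clm_apply continuous_const
  have mL := measurableSet_loopParam L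
  have mC := fun δ => measurableSet_crossParam L δ
  have hf : AEStronglyMeasurable (fun x => g₀ x + g₁ x) volume := hg₀.add hg₁
  have hcirc : ∀ s, ρ s * ‖∫ t in (max 0 (-s) + δ)..(1 - δ), fderiv ℝ W (s + t, t) (1, 1)‖ₑ ≤
      ρ s * (∫⁻ t in Prod.mk s ⁻¹' (loopParam L \ crossParam L δ),
        ‖fderiv ℝ W (diagMap (s, t)) (1, 1)‖ₑ) +
      ρ s * (∫⁻ t in Prod.mk s ⁻¹' loopParam L, ‖partialDeriv 0 W (topMap (s, t))‖ₑ) +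
      ρ s * ∫⁻ t in Prod.mk s ⁻¹' loopParam L, ‖partialDeriv 1 W (leftMap (s, t))‖ₑ := by
    intro s
    by_cases hs : s ∈ Ioo (-1 / 2) (2 * L - 1)
    · rw [← mul_add, ← mul_add, preimage_sdiff, preimage_loopParam hs, preimage_crossParam hs]
      gcongr
      have h1 := hs.1
      have h2 : max 0 (-s) ≤ 1 / 2 := max_le (by norm_num) (by linarith)
      exact enorm_integral_diagonal_le hW1 (by linarith [le_max_right 0 (-s), le_max_left 0 (-s)])
        (by linarith) (by linarith)
    · simp [hρS s hs]
  have m1 : Measurable fun p => ‖fderiv ℝ W (diagMap p) (1, 1)‖ₑ :=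
    (hF.measurable.comp measurePreserving_diagMap.measurable).enorm
  have m2 : Measurable fun p => ‖partialDeriv 0 W (topMap p)‖ₑ :=
    (hP.measurable.comp measurePreserving_topMap.measurable).enorm
  have m3 : Measurable fun p => ‖partialDeriv 1 W (leftMap p)‖ₑ :=
    (hQ.measurable.comp measurePreserving_leftMap.measurable).enorm
  have s1 : ∫⁻ p in loopParam L \ crossParam L δ, ρ p.1 * ‖fderiv ℝ W (diagMap p) (1, 1)‖ₑ ≤
      (∫⁻ p in loopParam L \ crossParam L 0, ρ p.1 * ‖g₀ (diagMap p) + g₁ (diagMap p)‖ₑ) +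
        η + η := by
    have hsub : loopParam L \ crossParam L δ ⊆
        (loopParam L \ crossParam L 0) ∪ (crossParam L 0 \ crossParam L δ) := by
      rintro p ⟨h1, h2⟩
      by_cases h : p ∈ crossParam L 0
      exacts [Or.inr ⟨h, h2⟩, Or.inl ⟨h1, h⟩]
    refine (setLIntegral_weight_comp_le (B := closedBall 0 (10 * L + 10)) measurePreserving_diagMap
      measurableSet_closedBall
      (mapsTo_closedBall.1.mono_left sdiff_subset) hρ1 (h := fun x => ‖fderiv ℝ W x (1, 1)‖ₑ)
      (k := fun x => ‖g₀ x + g₁ x‖ₑ)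
      (e := fun x => ‖fderiv ℝ W x (1, 1) - (g₀ x + g₁ x)‖ₑ)
      (hF.aestronglyMeasurable.sub hf).enorm (fun x => enorm_le_add_enorm_sub _ _)).trans ?_
    refine add_le_add ?_ hW.diag
    refine (lintegral_mono_set hsub).trans ((lintegral_union_le _ _ _).trans ?_)
    gcongr
    calc ∫⁻ p in crossParam L 0 \ crossParam L δ, ρ p.1 * ‖g₀ (diagMap p) + g₁ (diagMap p)‖ₑ
        ≤ ∫⁻ p in crossParam L 0 \ crossParam L δ, ‖g₀ (diagMap p) + g₁ (diagMap p)‖ₑ :=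
          lintegral_mono fun p => mul_le_of_le_one_left' (hρ1 _)
      _ ≤ η := (setLIntegral_comp_le measurePreserving_diagMap
          ((measurableSet_nucleus L).diff (isCompact_nucleusCore L _).measurableSet)
          (mapsTo_diagMap_layer hδ) hf.enorm).trans hlayer
  have s2 : ∫⁻ p in loopParam L, ρ p.1 * ‖partialDeriv 0 W (topMap p)‖ₑ ≤
      (∫⁻ p in loopParam L, ρ p.1 * ‖g₀ (topMap p)‖ₑ) + η :=
    (setLIntegral_weight_comp_le (B := closedBall 0 (10 * L + 10)) measurePreserving_topMap
      measurableSet_closedBall mapsTo_closedBall.2.1 hρ1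
      (h := fun x => ‖partialDeriv 0 W x‖ₑ) (k := fun x => ‖g₀ x‖ₑ)
      (hP.aestronglyMeasurable.sub hg₀).enorm fun x => enorm_le_add_enorm_sub _ _).trans
      (add_le_add le_rfl hW.fst)
  have s3 : ∫⁻ p in loopParam L, ρ p.1 * ‖partialDeriv 1 W (leftMap p)‖ₑ ≤
      (∫⁻ p in loopParam L, ρ p.1 * ‖g₁ (leftMap p)‖ₑ) + η :=
    (setLIntegral_weight_comp_le (B := closedBall 0 (10 * L + 10)) measurePreserving_leftMap
      measurableSet_closedBall mapsTo_closedBall.2.2 hρ1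
      (h := fun x => ‖partialDeriv 1 W x‖ₑ) (k := fun x => ‖g₁ x‖ₑ)
      (hQ.aestronglyMeasurable.sub hg₁).enorm fun x => enorm_le_add_enorm_sub _ _).trans
      (add_le_add le_rfl hW.snd)
  refine (lintegral_mono hcirc).trans ?_
  rw [lintegral_add_right _ (measurable_weight_section mL hρ m3),
    lintegral_add_right _ (measurable_weight_section mL hρ m2),
    ← setLIntegral_weight_mul (mL.diff (mC δ)) hρ m1, ← setLIntegral_weight_mul mL hρ m2,
    ← setLIntegral_weight_mul mL hρ m3]
  refine (add_le_add (add_le_add s1 s2) s3).trans (le_of_eq ?_)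
  rw [loopExterior]
  ring

theorem lintegral_weight_wellDist_le (hW : IsSmoothApprox L δ η T g₀ g₁ W) (hδ : 0 ≤ δ)
    (hρ : Measurable ρ) (hρ1 : ∀ s, ρ s ≤ 1)
    (hg₀ : AEStronglyMeasurable g₀ volume) (hg₁ : AEStronglyMeasurable g₁ volume) (θ : ℝ) :
    ∫⁻ s, ρ s * (∫⁻ t in Prod.mk s ⁻¹' crossParam L δ,
        ENNReal.ofReal (wellDist θ (fderiv ℝ W (diagMap (s, t)) (1, 1)))) ≤
      (∫⁻ p in crossParam L 0,
        ρ p.1 * ENNReal.ofReal (wellDist θ (g₀ (diagMap p) + g₁ (diagMap p)))) + η := by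
  have hW1 : ContDiff ℝ 1 W := hW.contDiff.of_le (by simp)
  have hF : Continuous fun x => fderiv ℝ W x (1, 1) :=
    (hW1.continuous_fderiv one_ne_zero).clm_apply continuous_const
  have hf : AEStronglyMeasurable (fun x => g₀ x + g₁ x) volume := hg₀.add hg₁
  have m1 : Measurable fun p => ENNReal.ofReal (wellDist θ (fderiv ℝ W (diagMap p) (1, 1))) :=
    (((continuous_wellDist θ).comp hF).measurable.comp
      measurePreserving_diagMap.measurable).ennreal_ofReal
  have hsub : crossParam L δ ⊆ crossParam L 0 := by
    rintro p ⟨h1, h2, h3⟩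
    exact ⟨h1, by linarith, by linarith⟩
  rw [← setLIntegral_weight_mul (measurableSet_crossParam L δ) hρ m1]
  refine (lintegral_mono_set hsub).trans ?_
  refine (setLIntegral_weight_comp_le (B := closedBall 0 (10 * L + 10)) measurePreserving_diagMap
    measurableSet_closedBall
    (mapsTo_closedBall.1.mono_left (crossParam_subset_loopParam le_rfl)) hρ1
    (h := fun x => ENNReal.ofReal (wellDist θ (fderiv ℝ W x (1, 1))))
    (k := fun x => ENNReal.ofReal (wellDist θ (g₀ x + g₁ x)))
    (e := fun x => ‖fderiv ℝ W x (1, 1) - (g₀ x + g₁ x)‖ₑ)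
    (hF.aestronglyMeasurable.sub hf).enorm (fun x => ?_)).trans (add_le_add le_rfl hW.diag)
  rw [← ofReal_norm, ← ENNReal.ofReal_add (wellDist_nonneg _ _) (norm_nonneg _)]
  exact ENNReal.ofReal_le_ofReal (wellDist_le_add _ _ _)

theorem lintegral_weight_variation_le (hW : IsSmoothApprox L δ η T g₀ g₁ W)
    (hρ : Measurable ρ) (hρ1 : ∀ s, ρ s ≤ 1) :
    ∫⁻ s, ρ s * (∫⁻ t in Prod.mk s ⁻¹' crossParam L δ,
      ‖fderiv ℝ (fun y => fderiv ℝ W y (1, 1)) (diagMap (s, t)) (1, 1)‖ₑ) ≤ T := by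
  have hW2 : ContDiff ℝ 1 fun y => fderiv ℝ W y (1, 1) :=
    ((hW.contDiff.fderiv_right (m := ∞) le_rfl).clm_apply contDiff_const).of_le (by simp)
  have hF : Continuous fun x => fderiv ℝ (fun y => fderiv ℝ W y (1, 1)) x (1, 1) :=
    (hW2.continuous_fderiv one_ne_zero).clm_apply continuous_const
  rw [← setLIntegral_weight_mul (measurableSet_crossParam L δ) hρ
    (h := fun p => ‖fderiv ℝ (fun y => fderiv ℝ W y (1, 1)) (diagMap p) (1, 1)‖ₑ)
    (hF.measurable.comp measurePreserving_diagMap.measurable).enorm]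
  calc _ ≤ ∫⁻ p in crossParam L δ,
        ‖fderiv ℝ (fun y => fderiv ℝ W y (1, 1)) (diagMap p) (1, 1)‖ₑ :=
        lintegral_mono fun p => mul_le_of_le_one_left' (hρ1 _)
    _ ≤ T := (setLIntegral_comp_le measurePreserving_diagMap
        (isCompact_nucleusCore L δ).measurableSet mapsTo_diagMap_core
        (h := fun x => ‖fderiv ℝ (fun y => fderiv ℝ W y (1, 1)) x (1, 1)‖ₑ)
        hF.measurable.enorm.aemeasurable).trans hW.var_diag

/-- The bound `well_lower_bound` on the crossing with parameter `s`, whose length is at least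
`1 / 2 - 2 * δ`. -/
theorem line_lower_bound (hW : ContDiff ℝ ∞ W) (hδ' : δ ≤ 1 / 16) (hθ : 0 < θ)
    (hθ' : θ ≤ 1 / 2) {s : ℝ} (hs : s ∈ Ioo (-1 / 2) (2 * L - 1)) :
    ENNReal.ofReal (θ / 8) ≤
      ‖∫ t in (max 0 (-s) + δ)..(1 - δ), fderiv ℝ W (s + t, t) (1, 1)‖ₑ +
      (∫⁻ t in Prod.mk s ⁻¹' crossParam L δ,
        ENNReal.ofReal (wellDist θ (fderiv ℝ W (diagMap (s, t)) (1, 1)))) +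
      ENNReal.ofReal θ * ∫⁻ t in Prod.mk s ⁻¹' crossParam L δ,
        ‖fderiv ℝ (fun y => fderiv ℝ W y (1, 1)) (diagMap (s, t)) (1, 1)‖ₑ := by
  have hW2 : ContDiff ℝ 1 fun y => fderiv ℝ W y (1, 1) :=
    ((hW.fderiv_right (m := ∞) le_rfl).clm_apply contDiff_const).of_le (by simp)
  rw [preimage_crossParam hs]
  have h2 : max 0 (-s) ≤ 1 / 2 := max_le (by norm_num) (by linarith [hs.1])
  refine well_lower_bound_lintegral (p := fun t => fderiv ℝ W (s + t, t) (1, 1))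
    (p' := fun t => fderiv ℝ (fun y => fderiv ℝ W y (1, 1)) (s + t, t) (1, 1))
    (fun t => ?_) ?_ (by linarith) hθ hθ'
  · exact hasDerivAt_comp_line hW2 ((hasDerivAt_id t).const_add s) (hasDerivAt_id t)
  · exact ((hW2.continuous_fderiv one_ne_zero).comp (by fun_prop)).clm_apply continuous_const

/-! ### Integrated lower bounds -/

/-- The weighted distance of `g₀ + g₁` to the wells on the diagonals crossing the nucleus. -/
noncomputable def crossWellDist (L θ : ℝ) (g₀ g₁ : Plane → ℝ) (ρ : ℝ → ℝ≥0∞) : ℝ≥0∞ :=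
  ∫⁻ p in crossParam L 0, ρ p.1 * ENNReal.ofReal (wellDist θ (g₀ (diagMap p) + g₁ (diagMap p)))

/-- The pair `(g₀, g₁)` has smooth approximations of arbitrary quality. -/
def HasSmoothApprox (L : ℝ) (T : ℝ≥0∞) (g₀ g₁ : Plane → ℝ) : Prop :=
  ∀ η : ℝ≥0∞, 0 < η → ∃ (δ : ℝ) (W : Plane → ℝ), 0 < δ ∧ δ ≤ 1 / 16 ∧
    ∫⁻ x in nucleus L \ nucleusCore L (2 * δ), ‖g₀ x + g₁ x‖ₑ ≤ η ∧
    IsSmoothApprox L δ η T g₀ g₁ W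

theorem measurable_wellDist_section (hW : IsSmoothApprox L δ η T g₀ g₁ W) (hρ : Measurable ρ)
    (θ : ℝ) : Measurable fun s => ρ s * (∫⁻ t in Prod.mk s ⁻¹' crossParam L δ,
      ENNReal.ofReal (wellDist θ (fderiv ℝ W (diagMap (s, t)) (1, 1)))) := by
  have hW1 : ContDiff ℝ 1 W := hW.contDiff.of_le (by simp)
  have hF : Continuous fun x => fderiv ℝ W x (1, 1) :=
    (hW1.continuous_fderiv one_ne_zero).clm_apply continuous_const
  exact measurable_weight_section (h := fun p => ENNReal.ofReal (wellDist θ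
    (fderiv ℝ W (diagMap p) (1, 1)))) (measurableSet_crossParam L δ) hρ
    (((continuous_wellDist θ).comp hF).measurable.comp
      measurePreserving_diagMap.measurable).ennreal_ofReal

theorem measurable_variation_section (hW : IsSmoothApprox L δ η T g₀ g₁ W) (hρ : Measurable ρ) :
    Measurable fun s => ρ s * (∫⁻ t in Prod.mk s ⁻¹' crossParam L δ,
      ‖fderiv ℝ (fun y => fderiv ℝ W y (1, 1)) (diagMap (s, t)) (1, 1)‖ₑ) := by
  have hW2 : ContDiff ℝ 1 fun y => fderiv ℝ W y (1, 1) :=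
    ((hW.contDiff.fderiv_right (m := ∞) le_rfl).clm_apply contDiff_const).of_le (by simp)
  have hF : Continuous fun x => fderiv ℝ (fun y => fderiv ℝ W y (1, 1)) x (1, 1) :=
    (hW2.continuous_fderiv one_ne_zero).clm_apply continuous_const
  exact measurable_weight_section
    (h := fun p => ‖fderiv ℝ (fun y => fderiv ℝ W y (1, 1)) (diagMap p) (1, 1)‖ₑ)
    (measurableSet_crossParam L δ) hρ
    (hF.measurable.comp measurePreserving_diagMap.measurable).enorm

/-- Integrating the lower bound on single lines against a weight. -/
theorem weighted_lower_bound (H : HasSmoothApprox L T g₀ g₁) (hθ : 0 < θ) (hθ' : θ ≤ 1 / 2)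
    (hρ : Measurable ρ) (hρ1 : ∀ s, ρ s ≤ 1)
    (hρS : ∀ s ∉ Ioo (-1 / 2) (2 * L - 1), ρ s = 0)
    (hg₀ : AEStronglyMeasurable g₀ volume) (hg₁ : AEStronglyMeasurable g₁ volume) :
    ENNReal.ofReal (θ / 8) * ∫⁻ s, ρ s ≤
      loopExterior L g₀ g₁ ρ + crossWellDist L θ g₀ g₁ ρ + ENNReal.ofReal θ * T := by
  refine ENNReal.le_of_forall_pos_le_add fun κ hκ _ => ?_
  obtain ⟨δ, W, hδ, hδ', hlayer, hW⟩ := H (κ / 5) (by simp [hκ.ne'])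
  calc ENNReal.ofReal (θ / 8) * ∫⁻ s, ρ s = ∫⁻ s, ENNReal.ofReal (θ / 8) * ρ s :=
        (lintegral_const_mul _ hρ).symm
    _ ≤ ∫⁻ s, (ρ s * ‖∫ t in (max 0 (-s) + δ)..(1 - δ), fderiv ℝ W (s + t, t) (1, 1)‖ₑ +
        ρ s * (∫⁻ t in Prod.mk s ⁻¹' crossParam L δ,
          ENNReal.ofReal (wellDist θ (fderiv ℝ W (diagMap (s, t)) (1, 1)))) +
        ENNReal.ofReal θ * (ρ s * ∫⁻ t in Prod.mk s ⁻¹' crossParam L δ,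
          ‖fderiv ℝ (fun y => fderiv ℝ W y (1, 1)) (diagMap (s, t)) (1, 1)‖ₑ)) := by
        refine lintegral_mono fun s => ?_
        by_cases hs : s ∈ Ioo (-1 / 2) (2 * L - 1)
        · calc ENNReal.ofReal (θ / 8) * ρ s ≤ _ * ρ s :=
                mul_le_mul_left (line_lower_bound hW.contDiff hδ' hθ hθ' hs) (ρ s)
            _ = _ := by ring
        · simp [hρS s hs]
    _ = (∫⁻ s, ρ s * ‖∫ t in (max 0 (-s) + δ)..(1 - δ), fderiv ℝ W (s + t, t) (1, 1)‖ₑ) +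
        (∫⁻ s, ρ s * (∫⁻ t in Prod.mk s ⁻¹' crossParam L δ,
          ENNReal.ofReal (wellDist θ (fderiv ℝ W (diagMap (s, t)) (1, 1))))) +
        ENNReal.ofReal θ * ∫⁻ s, ρ s * ∫⁻ t in Prod.mk s ⁻¹' crossParam L δ,
          ‖fderiv ℝ (fun y => fderiv ℝ W y (1, 1)) (diagMap (s, t)) (1, 1)‖ₑ := by
        rw [lintegral_add_right _ ((measurable_variation_section hW hρ).const_mul _),
          lintegral_add_right _ (measurable_wellDist_section hW hρ θ),
          lintegral_const_mul _ (measurable_variation_section hW hρ)]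
    _ ≤ (loopExterior L g₀ g₁ ρ + 4 * (κ / 5)) + (crossWellDist L θ g₀ g₁ ρ + κ / 5) +
        ENNReal.ofReal θ * T := by
        gcongr
        · exact lintegral_weight_diagonal_le hW hδ hδ' hρ hρ1 hρS hg₀ hg₁ hlayer
        · exact lintegral_weight_wellDist_le hW hδ.le hρ hρ1 hg₀ hg₁ θ
        · exact lintegral_weight_variation_le hW hρ hρ1
    _ = loopExterior L g₀ g₁ ρ + crossWellDist L θ g₀ g₁ ρ + ENNReal.ofReal θ * T +
        5 * (κ / 5) := by ring
    _ = _ := by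
        rw [ENNReal.mul_div_cancel (by norm_num) (by norm_num)]

/-- The integrals over two parallel diagonals differ at most by the variation in the horizontal
direction. -/
theorem enorm_diagonal_le_add (hW : IsSmoothApprox L δ η T g₀ g₁ W) (hδ : δ ≤ 1 / 16)
    {s s' : ℝ} (hs : s ∈ Ioo 0 (2 * L - 1)) (hs' : s' ∈ Ioo 0 (2 * L - 1)) :
    ‖∫ t in δ..(1 - δ), fderiv ℝ W (s' + t, t) (1, 1)‖ₑ ≤
      ‖∫ t in δ..(1 - δ), fderiv ℝ W (s + t, t) (1, 1)‖ₑ + T := by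
  set F : Plane → ℝ := fun y => fderiv ℝ W y (1, 1) with hF
  have hF1 : ContDiff ℝ 1 F :=
    ((hW.contDiff.fderiv_right (m := ∞) le_rfl).clm_apply contDiff_const).of_le (by simp)
  have hFc : ∀ s : ℝ, Continuous fun t => F (s + t, t) := fun s =>
    hF1.continuous.comp (by fun_prop)
  have hdc : Continuous fun x => fderiv ℝ F x (1, 0) :=
    (hF1.continuous_fderiv one_ne_zero).clm_apply continuous_const
  refine (enorm_le_add_enorm_sub _ (∫ t in δ..(1 - δ), F (s + t, t))).trans
    (add_le_add le_rfl ?_)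
  rw [← intervalIntegral.integral_sub ((hFc s').intervalIntegrable _ _)
    ((hFc s).intervalIntegrable _ _), intervalIntegral.integral_of_le (by linarith),
    integral_Ioc_eq_integral_Ioo]
  calc ‖∫ t in Ioo δ (1 - δ), (F (s' + t, t) - F (s + t, t))‖ₑ
      ≤ ∫⁻ t in Ioo δ (1 - δ), ‖F (s' + t, t) - F (s + t, t)‖ₑ :=
        enorm_integral_le_lintegral_enorm _
    _ ≤ ∫⁻ t in Ioo δ (1 - δ), ∫⁻ x in Icc δ (2 * L - δ), ‖fderiv ℝ F (x, t) (1, 0)‖ₑ := by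
        refine setLIntegral_mono' measurableSet_Ioo fun t ht => ?_
        have hsub : uIoc (s + t) (s' + t) ⊆ Icc δ (2 * L - δ) := by
          refine uIoc_subset_uIcc.trans (ordConnected_Icc.uIcc_subset ?_ ?_) <;>
          constructor <;> linarith [hs.1, hs.2, hs'.1, hs'.2, ht.1, ht.2]
        have hder : ∀ x ∈ uIcc (s + t) (s' + t),
            HasDerivAt (fun x => F (x, t)) (fderiv ℝ F (x, t) (1, 0)) x := fun x _ =>
          hasDerivAt_comp_line hF1 (hasDerivAt_id x) (hasDerivAt_const x t)
        have hc : Continuous fun x => fderiv ℝ F (x, t) (1, 0) :=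
          hdc.comp (by fun_prop : Continuous fun x : ℝ => (x, t))
        rw [← intervalIntegral.integral_eq_sub_of_hasDerivAt hder (hc.intervalIntegrable _ _),
          ← ofReal_norm, intervalIntegral.norm_intervalIntegral_eq, ofReal_norm]
        exact (enorm_integral_le_lintegral_enorm _).trans (lintegral_mono_set hsub)
    _ ≤ ∫⁻ t in Icc δ (1 - δ), ∫⁻ x in Icc δ (2 * L - δ), ‖fderiv ℝ F (x, t) (1, 0)‖ₑ :=
        lintegral_mono_set Ioo_subset_Icc_self
    _ = ∫⁻ x in nucleusCore L δ, ‖fderiv ℝ F x (1, 0)‖ₑ := by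
        rw [nucleusCore, Measure.volume_eq_prod, ← Measure.prod_restrict,
          lintegral_prod_symm _ hdc.measurable.enorm.aemeasurable]
    _ ≤ T := hW.var_fst

/-- Comparing all diagonals with each other: if the variation is small then either all of them
see a jump across the nucleus or all of them pay elastic energy. -/
theorem averaged_lower_bound (H : HasSmoothApprox L T g₀ g₁) (hθ : 0 < θ) (hθ' : θ ≤ 1 / 2)
    (hρ : Measurable ρ) (hρ1 : ∀ s, ρ s ≤ 1)
    (hρS : ∀ s ∉ Ioo 0 (2 * L - 1), ρ s = 0)
    (hg₀ : AEStronglyMeasurable g₀ volume) (hg₁ : AEStronglyMeasurable g₁ volume) :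
    ENNReal.ofReal (θ / 8) * ENNReal.ofReal (2 * L - 1) * ∫⁻ s, ρ s ≤
      ENNReal.ofReal (2 * L - 1) * loopExterior L g₀ g₁ ρ +
      (∫⁻ s, ρ s) * (ENNReal.ofReal (2 * L - 1) * T +
        crossWellDist L θ g₀ g₁ ((Ioo 0 (2 * L - 1)).indicator 1) + ENNReal.ofReal θ * T) := by
  set ℓ := ENNReal.ofReal (2 * L - 1) with hℓ
  set σ : ℝ → ℝ≥0∞ := (Ioo 0 (2 * L - 1)).indicator 1 with hσdef
  set Λ := ∫⁻ s, ρ s with hΛ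
  have hσm : Measurable σ := measurable_one.indicator measurableSet_Ioo
  have hσ1 : ∀ s, σ s ≤ 1 := fun s => indicator_le_self' (fun _ _ => zero_le) s
  have hσI : ∫⁻ s, σ s = ℓ := by
    rw [hσdef, lintegral_indicator_one measurableSet_Ioo, Real.volume_Ioo, hℓ, sub_zero]
  have hΛtop : Λ ≠ ⊤ := by
    refine ne_top_of_le_ne_top (b := ℓ) ENNReal.ofReal_ne_top ?_
    rw [← hσI]
    refine lintegral_mono fun s => ?_
    by_cases hs : s ∈ Ioo 0 (2 * L - 1)
    · simpa [hσdef, hs] using hρ1 s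
    · simp [hρS s hs]
  have hsub : Ioo 0 (2 * L - 1) ⊆ Ioo (-1 / 2) (2 * L - 1) := Ioo_subset_Ioo (by norm_num) le_rfl
  refine ENNReal.le_of_forall_pos_le_add fun κ hκ _ => ?_
  -- the error `4 * η` of the exterior term is multiplied by `ℓ`, the error `η` of `Q` by `Λ`
  have hC : ℓ * 4 + Λ ≠ ⊤ :=
    ENNReal.add_ne_top.2 ⟨ENNReal.mul_ne_top ENNReal.ofReal_ne_top (by norm_num), hΛtop⟩
  obtain ⟨η, hη, hηκ⟩ := ENNReal.exists_nnreal_pos_mul_lt hC (ENNReal.coe_ne_zero.2 hκ.ne')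
  obtain ⟨δ, W, hδ, hδ', hlayer, hW⟩ := H η (by simp [hη])
  set A : ℝ → ℝ≥0∞ := fun s =>
    ‖∫ t in (max 0 (-s) + δ)..(1 - δ), fderiv ℝ W (s + t, t) (1, 1)‖ₑ with hA
  have hAA : ∀ s ∈ Ioo 0 (2 * L - 1), ∀ s' ∈ Ioo 0 (2 * L - 1), A s' ≤ A s + T := by
    intro s hs s' hs'
    simp only [hA, max_eq_left (neg_nonpos.2 hs.1.le), max_eq_left (neg_nonpos.2 hs'.1.le),
      zero_add]
    exact enorm_diagonal_le_add hW hδ' hs hs'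
  set Q := crossWellDist L θ g₀ g₁ σ with hQ
  have step : ∀ s ∈ Ioo 0 (2 * L - 1),
      ENNReal.ofReal (θ / 8) * ℓ ≤ ℓ * A s + (ℓ * T + (Q + η) + ENNReal.ofReal θ * T) := by
    intro s hs
    calc ENNReal.ofReal (θ / 8) * ℓ = ∫⁻ s', ENNReal.ofReal (θ / 8) * σ s' := by
          rw [lintegral_const_mul _ hσm, hσI]
      _ ≤ ∫⁻ s', ((A s + T) * σ s' +
          σ s' * (∫⁻ t in Prod.mk s' ⁻¹' crossParam L δ,
            ENNReal.ofReal (wellDist θ (fderiv ℝ W (diagMap (s', t)) (1, 1)))) +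
          ENNReal.ofReal θ * (σ s' * ∫⁻ t in Prod.mk s' ⁻¹' crossParam L δ,
            ‖fderiv ℝ (fun y => fderiv ℝ W y (1, 1)) (diagMap (s', t)) (1, 1)‖ₑ)) := by
          refine lintegral_mono fun s' => ?_
          by_cases hs' : s' ∈ Ioo 0 (2 * L - 1)
          · have h1 := line_lower_bound hW.contDiff hδ' hθ hθ' (hsub hs')
            have h2 := hAA s hs s' hs'
            simp only [hσdef, indicator_of_mem hs', Pi.one_apply, mul_one, one_mul]
            exact h1.trans (by gcongr)
          · simp [hσdef, hs']
      _ = (A s + T) * ℓ + (∫⁻ s', σ s' * (∫⁻ t in Prod.mk s' ⁻¹' crossParam L δ,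
            ENNReal.ofReal (wellDist θ (fderiv ℝ W (diagMap (s', t)) (1, 1))))) +
          ENNReal.ofReal θ * ∫⁻ s', σ s' * ∫⁻ t in Prod.mk s' ⁻¹' crossParam L δ,
            ‖fderiv ℝ (fun y => fderiv ℝ W y (1, 1)) (diagMap (s', t)) (1, 1)‖ₑ := by
          rw [lintegral_add_right _ ((measurable_variation_section hW hσm).const_mul _),
            lintegral_add_right _ (measurable_wellDist_section hW hσm θ),
            lintegral_const_mul _ (measurable_variation_section hW hσm),
            lintegral_const_mul _ hσm, hσI]
      _ ≤ (A s + T) * ℓ + (Q + η) + ENNReal.ofReal θ * T := by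
          gcongr
          · exact lintegral_weight_wellDist_le hW hδ.le hσm hσ1 hg₀ hg₁ θ
          · exact lintegral_weight_variation_le hW hσm hσ1
      _ = _ := by ring
  calc ENNReal.ofReal (θ / 8) * ℓ * Λ = ∫⁻ s, ENNReal.ofReal (θ / 8) * ℓ * ρ s :=
        (lintegral_const_mul _ hρ).symm
    _ ≤ ∫⁻ s, (ℓ * (ρ s * A s) + (ℓ * T + (Q + η) + ENNReal.ofReal θ * T) * ρ s) := by
        refine lintegral_mono fun s => ?_
        by_cases hs : s ∈ Ioo 0 (2 * L - 1)
        · calc _ ≤ _ * ρ s := mul_le_mul_left (step s hs) (ρ s)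
            _ = _ := by ring
        · simp [hρS s hs]
    _ = ℓ * (∫⁻ s, ρ s * A s) + (ℓ * T + (Q + η) + ENNReal.ofReal θ * T) * Λ := by
        rw [lintegral_add_right _ (hρ.const_mul _), lintegral_const_mul' _ _ ENNReal.ofReal_ne_top,
          lintegral_const_mul _ hρ]
    _ ≤ ℓ * (loopExterior L g₀ g₁ ρ + 4 * η) +
        (ℓ * T + (Q + η) + ENNReal.ofReal θ * T) * Λ := by
        gcongr
        exact lintegral_weight_diagonal_le hW hδ hδ' hρ hρ1
          (fun s hs => hρS s fun h => hs (hsub h)) hg₀ hg₁ hlayer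
    _ = ℓ * loopExterior L g₀ g₁ ρ + Λ * (ℓ * T + Q + ENNReal.ofReal θ * T) +
        η * (ℓ * 4 + Λ) := by ring
    _ ≤ _ := by gcongr

/-! ### Elastic energies -/

theorem sq_setLIntegral_weight_le {Ψ : ℝ × ℝ → Plane} (hΨ : MeasurePreserving Ψ volume volume)
    {S : Set (ℝ × ℝ)} {U : Set Plane} (hU : MeasurableSet U) (hSU : MapsTo Ψ S U)
    (hρ : Measurable ρ) {h : Plane → ℝ≥0∞} (hh : AEMeasurable h volume) :
    (∫⁻ p in S, ρ p.1 * h (Ψ p)) ^ 2 ≤ (∫⁻ p in S, ρ p.1 * ρ p.1) * ∫⁻ x in U, h x ^ 2 := by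
  refine (sq_lintegral_mul_le (hρ.comp measurable_fst).aemeasurable
    (hh.comp_quasiMeasurePreserving hΨ.quasiMeasurePreserving).restrict).trans ?_
  refine mul_le_mul' (le_of_eq ?_) (setLIntegral_comp_le hΨ hU hSU (hh.pow_const 2))
  simp [sq]

theorem lintegral_weight_sq_loopParam_le {M : ℝ} (hρ : Measurable ρ)
    (hρM : ∀ s ∈ Ioo (-1 / 2) (2 * L - 1), ρ s * ENNReal.ofReal (s + 1) ≤ ENNReal.ofReal M)
    (hρS : ∀ s ∉ Ioo (-1 / 2) (2 * L - 1), ρ s = 0) :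
    ∫⁻ p in loopParam L, ρ p.1 * ρ p.1 ≤ 3 * ENNReal.ofReal M * ∫⁻ s, ρ s := by
  rw [setLIntegral_weight_mul (h := fun p => ρ p.1) (measurableSet_loopParam L) hρ
    (hρ.comp measurable_fst), ← lintegral_const_mul _ hρ]
  refine lintegral_mono fun s => ?_
  by_cases hs : s ∈ Ioo (-1 / 2) (2 * L - 1)
  · dsimp only
    rw [preimage_loopParam hs, setLIntegral_const, Real.volume_Ioo]
    have : s + 2 - -(2 * s + 1) = 3 * (s + 1) := by ring
    rw [this, ENNReal.ofReal_mul (by norm_num)]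
    calc ρ s * (ρ s * (ENNReal.ofReal 3 * ENNReal.ofReal (s + 1)))
        = 3 * (ρ s * ENNReal.ofReal (s + 1)) * ρ s := by
          rw [show ENNReal.ofReal 3 = 3 by simp]; ring
      _ ≤ 3 * ENNReal.ofReal M * ρ s :=
          mul_le_mul_left (mul_le_mul_right (hρM s hs) 3) (ρ s)
  · simp [hρS s hs]

theorem lintegral_weight_sq_crossParam_le (hρ : Measurable ρ) (hρ1 : ∀ s, ρ s ≤ 1)
    (hρS : ∀ s ∉ Ioo (-1 / 2) (2 * L - 1), ρ s = 0) :
    ∫⁻ p in crossParam L 0, ρ p.1 * ρ p.1 ≤ ∫⁻ s, ρ s := by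
  rw [setLIntegral_weight_mul (h := fun p => ρ p.1) (measurableSet_crossParam L 0) hρ
    (hρ.comp measurable_fst)]
  refine lintegral_mono fun s => ?_
  by_cases hs : s ∈ Ioo (-1 / 2) (2 * L - 1)
  · dsimp only
    rw [preimage_crossParam hs, setLIntegral_const, Real.volume_Ioo]
    have : ENNReal.ofReal (1 - 0 - (max 0 (-s) + 0)) ≤ 1 := by
      rw [← ENNReal.ofReal_one]
      exact ENNReal.ofReal_le_ofReal (by linarith [le_max_left 0 (-s)])
    calc ρ s * (ρ s * ENNReal.ofReal (1 - 0 - (max 0 (-s) + 0))) ≤ ρ s * (1 * 1) := by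
          gcongr; exact hρ1 s
      _ = ρ s := by simp
  · simp [hρS s hs]

theorem sq_add_add_le {a b c y : ℝ≥0∞} (ha : a ^ 2 ≤ y) (hb : b ^ 2 ≤ y) (hc : c ^ 2 ≤ y) :
    (a + b + c) ^ 2 ≤ 9 * y := by
  have hm : max a (max b c) ^ 2 ≤ y := by
    rcases max_choice a (max b c) with h | h <;> rw [h]
    · exact ha
    · rcases max_choice b c with h | h <;> rw [h] <;> assumption
  calc (a + b + c) ^ 2
      ≤ (max a (max b c) + max a (max b c) + max a (max b c)) ^ 2 := by
        gcongr <;> simp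
    _ = 9 * max a (max b c) ^ 2 := by ring
    _ ≤ 9 * y := by gcongr

/-- The elastic energy of the exterior controls the exterior part of the loops. -/
theorem sq_loopExterior_le {M : ℝ} (hρ : Measurable ρ)
    (hρM : ∀ s ∈ Ioo (-1 / 2) (2 * L - 1), ρ s * ENNReal.ofReal (s + 1) ≤ ENNReal.ofReal M)
    (hρS : ∀ s ∉ Ioo (-1 / 2) (2 * L - 1), ρ s = 0)
    (hg₀ : AEStronglyMeasurable g₀ volume) (hg₁ : AEStronglyMeasurable g₁ volume)
    {N : Plane → ℝ≥0∞} (h₀ : ∀ x, ‖g₀ x‖ₑ ^ 2 ≤ 4 * N x) (h₁ : ∀ x, ‖g₁ x‖ₑ ^ 2 ≤ 4 * N x)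
    (hf : ∀ x, ‖g₀ x + g₁ x‖ₑ ^ 2 ≤ 4 * N x) :
    loopExterior L g₀ g₁ ρ ^ 2 ≤
      108 * ENNReal.ofReal M * (∫⁻ s, ρ s) * ∫⁻ x in (nucleus L)ᶜ, N x := by
  have hU := (measurableSet_nucleus L).compl
  have hI := lintegral_weight_sq_loopParam_le hρ hρM hρS
  have aux : ∀ {h : Plane → ℝ≥0∞}, (∀ x, h x ^ 2 ≤ 4 * N x) →
      ∫⁻ x in (nucleus L)ᶜ, h x ^ 2 ≤ 4 * ∫⁻ x in (nucleus L)ᶜ, N x := fun hh => by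
    rw [← lintegral_const_mul' _ _ (by norm_num)]
    exact lintegral_mono hh
  have e : 108 * ENNReal.ofReal M * (∫⁻ s, ρ s) * ∫⁻ x in (nucleus L)ᶜ, N x =
      9 * ((3 * ENNReal.ofReal M * ∫⁻ s, ρ s) * (4 * ∫⁻ x in (nucleus L)ᶜ, N x)) := by ring
  rw [e, loopExterior]
  refine sq_add_add_le ?_ ?_ ?_
  · exact (sq_setLIntegral_weight_le measurePreserving_diagMap hU mapsTo_diagMap_compl hρ
      (h := fun x => ‖g₀ x + g₁ x‖ₑ) (hg₀.add hg₁).enorm).trans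
      (mul_le_mul' ((lintegral_mono_set sdiff_subset).trans hI) (aux hf))
  · exact (sq_setLIntegral_weight_le measurePreserving_topMap hU mapsTo_topMap_compl hρ
      (h := fun x => ‖g₀ x‖ₑ) hg₀.enorm).trans (mul_le_mul' hI (aux h₀))
  · exact (sq_setLIntegral_weight_le measurePreserving_leftMap hU mapsTo_leftMap_compl hρ
      (h := fun x => ‖g₁ x‖ₑ) hg₁.enorm).trans (mul_le_mul' hI (aux h₁))

/-- The elastic energy of the nucleus controls the distance to the wells along the diagonals. -/
theorem sq_crossWellDist_le (hρ : Measurable ρ) (hρ1 : ∀ s, ρ s ≤ 1)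
    (hρS : ∀ s ∉ Ioo (-1 / 2) (2 * L - 1), ρ s = 0)
    (hg₀ : AEStronglyMeasurable g₀ volume) (hg₁ : AEStronglyMeasurable g₁ volume)
    {N : Plane → ℝ≥0∞} (hN : ∀ x, ENNReal.ofReal (wellDist θ (g₀ x + g₁ x)) ^ 2 ≤ 4 * N x) :
    crossWellDist L θ g₀ g₁ ρ ^ 2 ≤ 4 * (∫⁻ s, ρ s) * ∫⁻ x in nucleus L, N x := by
  have hm : AEMeasurable (fun x => ENNReal.ofReal (wellDist θ (g₀ x + g₁ x))) volume :=
    ((continuous_wellDist θ).comp_aestronglyMeasurable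
      (hg₀.add hg₁)).aemeasurable.ennreal_ofReal
  refine (sq_setLIntegral_weight_le measurePreserving_diagMap (measurableSet_nucleus L)
    mapsTo_diagMap_nucleus hρ hm).trans ?_
  calc _ ≤ (∫⁻ s, ρ s) * ∫⁻ x in nucleus L, 4 * N x := by
        refine mul_le_mul' (lintegral_weight_sq_crossParam_le hρ hρ1 hρS) ?_
        exact lintegral_mono hN
    _ = _ := by rw [lintegral_const_mul' _ _ (by norm_num)]; ring

/-! ### Logarithmic weights -/

/-- The weight `M / (M + s + 1)` on `(a, b)`; it is constant up to a factor for `s ≲ M` and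
decays like the inverse length of the loop beyond. -/
noncomputable def logWeight (M a b : ℝ) : ℝ → ℝ≥0∞ :=
  (Ioo a b).indicator fun s => ENNReal.ofReal (M / (M + s + 1))

theorem measurable_logWeight (M a b : ℝ) : Measurable (logWeight M a b) := by
  unfold logWeight
  exact Measurable.indicator (by fun_prop) measurableSet_Ioo

theorem logWeight_le_one {M a b : ℝ} (hM : 0 < M) (ha : -1 ≤ a) (s : ℝ) :
    logWeight M a b s ≤ 1 := by
  refine indicator_le' (g := fun _ => 1) (fun s hs => ?_) (fun _ _ => zero_le) s
  rw [← ENNReal.ofReal_one]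
  refine ENNReal.ofReal_le_ofReal ?_
  rw [div_le_one (by linarith [hs.1])]
  linarith [hs.1]

theorem logWeight_mul_le {M a b : ℝ} (hM : 0 < M) (ha : -1 ≤ a) (s : ℝ) :
    logWeight M a b s * ENNReal.ofReal (s + 1) ≤ ENNReal.ofReal M := by
  by_cases hs : s ∈ Ioo a b
  · have h : 0 < M + s + 1 := by linarith [hs.1]
    rw [logWeight, indicator_of_mem hs, ← ENNReal.ofReal_mul (by positivity)]
    refine ENNReal.ofReal_le_ofReal ?_
    rw [div_mul_eq_mul_div, div_le_iff₀ h]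
    nlinarith
  · simp [logWeight, hs]

theorem logWeight_of_notMem {M a b s : ℝ} (hs : s ∉ Ioo a b) : logWeight M a b s = 0 :=
  indicator_of_notMem hs _

theorem lintegral_logWeight {M a b : ℝ} (hM : 0 < M) (ha : -1 ≤ a) (hab : a ≤ b) :
    ∫⁻ s, logWeight M a b s = ENNReal.ofReal (M * Real.log ((M + b + 1) / (M + a + 1))) := by
  have hpos : ∀ s ∈ uIcc a b, 0 < M + s + 1 := fun s hs => by
    rw [uIcc_of_le hab] at hs; linarith [hs.1]
  have hcont : ContinuousOn (fun s => M / (M + s + 1)) (uIcc a b) :=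
    continuousOn_const.div (by fun_prop) fun s hs => (hpos s hs).ne'
  have hint : ∫ s in a..b, M / (M + s + 1) = M * Real.log ((M + b + 1) / (M + a + 1)) := by
    rw [Real.log_div (hpos b right_mem_uIcc).ne' (hpos a left_mem_uIcc).ne', mul_sub]
    refine intervalIntegral.integral_eq_sub_of_hasDerivAt (f := fun s => M * Real.log (M + s + 1))
      (fun s hs => ?_) hcont.intervalIntegrable
    have h1 : HasDerivAt (fun s : ℝ => M + s + 1) 1 s :=
      ((hasDerivAt_id s).const_add M).add_const 1
    exact ((h1.log (hpos s hs).ne').const_mul M).congr_deriv (by ring)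
  rw [logWeight, lintegral_indicator measurableSet_Ioo, ← hint,
    intervalIntegral.integral_of_le hab, integral_Ioc_eq_integral_Ioo,
    ofReal_integral_eq_lintegral_ofReal]
  · rw [uIcc_of_le hab] at hcont
    exact hcont.integrableOn_Icc.mono_set Ioo_subset_Icc_self
  · refine (ae_restrict_iff' measurableSet_Ioo).2 (Eventually.of_forall fun s hs => ?_)
    exact div_nonneg hM.le (by linarith [hs.1])

/-! ### Reduction to the scalar problem -/

theorem normSq_bounds (A : Matrix (Fin 2) (Fin 2) ℝ) :
    (A 0 0 + A 0 1) ^ 2 ≤ 4 * normSq A ∧ (A 1 0 + A 1 1) ^ 2 ≤ 4 * normSq A ∧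
      (A 0 0 + A 0 1 + (A 1 0 + A 1 1)) ^ 2 ≤ 4 * normSq A := by
  simp only [normSq, Fin.sum_univ_two]
  refine ⟨?_, ?_, ?_⟩
  · nlinarith [sq_nonneg (A 0 0 - A 0 1), sq_nonneg (A 1 0), sq_nonneg (A 1 1), sq_nonneg (A 0 0),
      sq_nonneg (A 0 1)]
  · nlinarith [sq_nonneg (A 1 0 - A 1 1), sq_nonneg (A 0 0), sq_nonneg (A 0 1), sq_nonneg (A 1 0),
      sq_nonneg (A 1 1)]
  · nlinarith [sq_nonneg (A 0 0 - A 0 1), sq_nonneg (A 1 0 - A 1 1), sq_nonneg (A 0 0 - A 1 0),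
      sq_nonneg (A 0 0 - A 1 1), sq_nonneg (A 0 1 - A 1 0), sq_nonneg (A 0 1 - A 1 1)]

/-- The entry sum `ξ · A ξ` with `ξ = (1, 1)` only sees the symmetric part of `A`, and it turns the
two wells of the strain into the wells `θ` and `θ - 1`. -/
theorem sq_wellDist_le (θ : ℝ) (A : Matrix (Fin 2) (Fin 2) ℝ) :
    wellDist θ (A 0 0 + A 0 1 + (A 1 0 + A 1 1)) ^ 2 ≤
      4 * min (normSq (symPart A - θ • e₁e₂)) (normSq (symPart A + (1 - θ) • e₁e₂)) := by
  have h1 := (normSq_bounds (symPart A - θ • e₁e₂)).2.2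
  have h2 := (normSq_bounds (symPart A + (1 - θ) • e₁e₂)).2.2
  have e1 : ∀ c : ℝ, (symPart A + c • e₁e₂) 0 0 + (symPart A + c • e₁e₂) 0 1 +
      ((symPart A + c • e₁e₂) 1 0 + (symPart A + c • e₁e₂) 1 1) =
      A 0 0 + A 0 1 + (A 1 0 + A 1 1) + c := by
    intro c
    simp [symPart, e₁e₂]
    ring
  rw [sub_eq_add_neg, ← neg_smul, e1] at h1
  rw [e1] at h2
  rw [mul_min_of_nonneg _ _ (by norm_num : (0 : ℝ) ≤ 4)]
  refine le_min ?_ ?_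
  · rw [sub_eq_add_neg, ← neg_smul]
    refine le_trans ?_ h1
    rw [← sub_eq_add_neg, ← sq_abs (A 0 0 + A 0 1 + (A 1 0 + A 1 1) - θ)]
    exact pow_le_pow_left₀ (wellDist_nonneg _ _) (min_le_left _ _) 2
  · refine le_trans ?_ h2
    rw [← sq_abs (A 0 0 + A 0 1 + (A 1 0 + A 1 1) + (1 - θ))]
    exact pow_le_pow_left₀ (wellDist_nonneg _ _) (min_le_right _ _) 2

theorem hasSmoothApprox_of_admissible {u : Plane → Fin 2 → ℝ} (hu : u ∈ admissible L) :
    HasSmoothApprox L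
      (4 * totalVariation (nucleus L) (fun x (p : Fin 2 × Fin 2) => weakGradient u x p.1 p.2))
      (fun x => weakGradient u x 0 0 + weakGradient u x 0 1)
      (fun x => weakGradient u x 1 0 + weakGradient u x 1 1) := by
  obtain ⟨⟨-, G, hG, -⟩, hBV, -⟩ := hu
  have hw := isWeakGradient_weakGradient ⟨G, hG⟩
  set D := weakGradient u
  have hsum : (fun x => ∑ p : Fin 2 × Fin 2, D x p.1 p.2) =
      fun x => D x 0 0 + D x 0 1 + (D x 1 0 + D x 1 1) := by
    ext x
    simp [Fintype.sum_prod_type, Fin.sum_univ_two]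
  have hdir : ∀ d : Plane, d.1 ^ 2 ≤ 1 → d.2 ^ 2 ≤ 1 →
      directionalVariation (nucleus L) (fun x => D x 0 0 + D x 0 1 + (D x 1 0 + D x 1 1)) d ≤
      4 * totalVariation (nucleus L) (fun x (p : Fin 2 × Fin 2) => D x p.1 p.2) := by
    intro d h1 h2
    rw [← hsum]
    exact directionalVariation_sum_le (F := fun x (p : Fin 2 × Fin 2) => D x p.1 p.2)
      (fun p => (hBV p.1 p.2).1) h1 h2
  have hweak : ∀ i, ∀ ψ : Plane → ℝ, ContDiff ℝ ∞ ψ → HasCompactSupport ψ →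
      ∫ x, (u x 0 + u x 1) * partialDeriv i ψ x = -∫ x, (D x i 0 + D x i 1) * ψ x := by
    intro i ψ hψ hc
    have hdc : Continuous (partialDeriv i ψ) :=
      (hψ.continuous_fderiv (by simp)).clm_apply continuous_const
    have hds : HasCompactSupport (partialDeriv i ψ) :=
      (hc.fderiv ℝ).comp_left (g := fun l : Plane →L[ℝ] ℝ =>
        l ((![(1, 0), (0, 1)] : Fin 2 → Plane) i)) (by simp)
    have i1 : ∀ j, Integrable (fun x => u x j * partialDeriv i ψ x) volume := fun j => by
      simpa [mul_comm] using (hw.1 j).integrable_smul_left_of_hasCompactSupport hdc hds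
    have i2 : ∀ j, Integrable (fun x => D x i j * ψ x) volume := fun j => by
      simpa [mul_comm] using
        (hw.2.1 i j).integrable_smul_left_of_hasCompactSupport hψ.continuous hc
    simp only [add_mul]
    rw [integral_add (i1 0) (i1 1), integral_add (i2 0) (i2 1), hw.2.2 i 0 ψ hψ hc,
      hw.2.2 i 1 ψ hψ hc]
    ring
  intro η hη
  have hint : IntegrableOn (fun x => D x 0 0 + D x 0 1 + (D x 1 0 + D x 1 1)) (nucleus L) volume :=
    ((hBV 0 0).1.add (hBV 0 1).1).add ((hBV 1 0).1.add (hBV 1 1).1)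
  obtain ⟨δ, hδ, hδ', hlayer⟩ := exists_lintegral_diff_nucleusCore_le L
    (h := fun x => ‖D x 0 0 + D x 0 1 + (D x 1 0 + D x 1 1)‖ₑ) hint.2.ne hη
  obtain ⟨W, hW⟩ := exists_isSmoothApprox (L := L) (δ := δ / 2) (w := fun x => u x 0 + u x 1)
    (g₀ := fun x => D x 0 0 + D x 0 1) (g₁ := fun x => D x 1 0 + D x 1 1)
    ((hw.1 0).add (hw.1 1)) ((hw.2.1 0 0).add (hw.2.1 0 1)) ((hw.2.1 1 0).add (hw.2.1 1 1))
    (hweak 0) (hweak 1) (hdir (1, 1) (by norm_num) (by norm_num))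
    (hdir (1, 0) (by norm_num) (by norm_num)) (by positivity) hη.ne'
  refine ⟨δ / 2, W, by positivity, by linarith, ?_, hW⟩
  rw [mul_div_cancel₀ _ two_ne_zero]
  exact hlayer

end WeightedBounds

/-! ### Lower bounds for the energy -/

/-- If `θ * Λ / 8` is at most the sum of an exterior term `P`, an elastic term `Q` and a variation
term, then one of them is at least a third of it. Here `v` stands for the total variation, `e` and
`x` for the elastic energies inside and outside, and `m` is the resulting cost per unit weight. The worst case is the
exterior term, where `62208 = 108 * 24 ^ 2`. -/
theorem energy_bound_of_weighted {μ ε θ M Λ m x e v P Q : ℝ} (hθ : 0 < θ) (hμ : 0 < μ) (hε : 0 < ε)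
    (hM : 0 < M) (hΛ : 0 ≤ Λ) (hx : 0 ≤ x) (he : 0 ≤ e) (hv : 0 ≤ v)
    (h1 : m ≤ μ * θ ^ 2 / M) (h2 : m ≤ θ ^ 2) (h3 : m ≤ ε)
    (hP : P ^ 2 ≤ 108 * M * Λ * x) (hQ : Q ^ 2 ≤ 4 * Λ * e)
    (h : θ / 8 * Λ ≤ P + Q + θ * (4 * v)) :
    1 / 70000 * (m * Λ) ≤ μ * x + e + ε * v := by
  have hxμ : 0 ≤ μ * x := by positivity
  have hvε : 0 ≤ ε * v := by positivity
  rcases hΛ.eq_or_lt with rfl | hΛ'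
  · simp only [mul_zero]; positivity
  rcases le_or_gt (θ * Λ / 24) P with hP' | hP'
  · have h4 : (θ * Λ / 24) ^ 2 ≤ 108 * M * Λ * x :=
      (pow_le_pow_left₀ (by positivity) hP' 2).trans hP
    have h5 : θ ^ 2 * Λ ≤ 62208 * (M * x) := by
      refine le_of_mul_le_mul_right ?_ hΛ'
      nlinarith
    have h6 : m * M ≤ μ * θ ^ 2 := by rwa [le_div_iff₀ hM] at h1
    have h7 : m * Λ ≤ 62208 * (μ * x) := by
      refine le_of_mul_le_mul_right ?_ hM
      nlinarith [mul_le_mul_of_nonneg_right h6 hΛ, mul_le_mul_of_nonneg_left h5 hμ.le]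
    nlinarith
  rcases le_or_gt (θ * Λ / 24) Q with hQ' | hQ'
  · have h4 : (θ * Λ / 24) ^ 2 ≤ 4 * Λ * e := (pow_le_pow_left₀ (by positivity) hQ' 2).trans hQ
    have h5 : θ ^ 2 * Λ ≤ 2304 * e := by
      refine le_of_mul_le_mul_right ?_ hΛ'
      nlinarith
    nlinarith [mul_le_mul_of_nonneg_right h2 hΛ]
  · have h4 : Λ ≤ 96 * v := by
      refine le_of_mul_le_mul_left ?_ hθ
      linarith
    nlinarith [mul_le_mul_of_nonneg_right h3 hΛ, mul_le_mul_of_nonneg_left h4 hε.le]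

/-- The analogue of `energy_bound_of_weighted` for `averaged_lower_bound`. -/
theorem energy_bound_of_averaged {μ ε θ Λ ℓ x e v P Q : ℝ} (hθ : 0 < θ) (hθ' : θ ≤ 1 / 2)
    (hμ : 0 < μ) (hε : 0 < ε) (hΛ : 0 < Λ) (hℓ : 1 ≤ ℓ) (hx : 0 ≤ x) (he : 0 ≤ e) (hv : 0 ≤ v)
    (hP : P ^ 2 ≤ 108 * Λ * x) (hQ : Q ^ 2 ≤ 4 * ℓ * e)
    (h : θ / 8 * ℓ * Λ ≤ ℓ * P + Λ * (ℓ * (4 * v) + Q + θ * (4 * v))) :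
    1 / 70000 * min (μ * θ ^ 2 * Λ) (min (θ ^ 2 * ℓ) (ε * θ)) ≤ μ * x + e + ε * v := by
  have hxμ : 0 ≤ μ * x := by positivity
  have hvε : 0 ≤ ε * v := by positivity
  have hℓ0 : 0 < ℓ := by linarith
  have m1 := min_le_left (μ * θ ^ 2 * Λ) (min (θ ^ 2 * ℓ) (ε * θ))
  have m2 := (min_le_right (μ * θ ^ 2 * Λ) (min (θ ^ 2 * ℓ) (ε * θ))).trans (min_le_left _ _)
  have m3 := (min_le_right (μ * θ ^ 2 * Λ) (min (θ ^ 2 * ℓ) (ε * θ))).trans (min_le_right _ _)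
  rcases le_or_gt (θ * Λ / 24) P with hP' | hP'
  · have h4 : (θ * Λ / 24) ^ 2 ≤ 108 * Λ * x := (pow_le_pow_left₀ (by positivity) hP' 2).trans hP
    have h5 : θ ^ 2 * Λ ≤ 62208 * x := by
      refine le_of_mul_le_mul_right ?_ hΛ
      nlinarith
    nlinarith [mul_le_mul_of_nonneg_left h5 hμ.le]
  rcases le_or_gt (θ * ℓ / 24) Q with hQ' | hQ'
  · have h4 : (θ * ℓ / 24) ^ 2 ≤ 4 * ℓ * e := (pow_le_pow_left₀ (by positivity) hQ' 2).trans hQ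
    have h5 : θ ^ 2 * ℓ ≤ 2304 * e := by
      refine le_of_mul_le_mul_right ?_ hℓ0
      nlinarith
    linarith
  · have h4 : θ ≤ 144 * v := by
      have hpos : 0 < ℓ * Λ := by positivity
      have a1 : ℓ * P ≤ ℓ * (θ * Λ / 24) := by gcongr
      have a2 : Λ * Q ≤ Λ * (θ * ℓ / 24) := by gcongr
      have a3 : θ * v ≤ 1 / 2 * (ℓ * v) := by nlinarith [mul_nonneg hv (sub_nonneg.2 hℓ)]
      have a4 : Λ * (θ * v) ≤ Λ * (1 / 2 * (ℓ * v)) := by gcongr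
      refine le_of_mul_le_mul_right ?_ hpos
      nlinarith
    nlinarith [mul_le_mul_of_nonneg_left h4 hε.le]

section EnergyBounds

variable {L μ ε θ : ℝ} {u : Plane → Fin 2 → ℝ}

/-- The two lower bounds, with the exterior energy `X`, the interior energy `E` and the total
variation `V` as extended nonnegative numbers. -/
theorem energy_inequalities (hu : u ∈ admissible L) (hθ : 0 < θ) (hθ' : θ ≤ 1 / 2) {X E V : ℝ≥0∞}
    (hX : X = ∫⁻ x in (nucleus L)ᶜ, ENNReal.ofReal (normSq (weakGradient u x)))
    (hE : E = ∫⁻ x in nucleus L, ENNReal.ofReal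
      (min (normSq (strain u x - θ • e₁e₂)) (normSq (strain u x + (1 - θ) • e₁e₂))))
    (hV : V = totalVariation (nucleus L)
      (fun x (p : Fin 2 × Fin 2) => weakGradient u x p.1 p.2)) :
    (∀ {M : ℝ} {ρ : ℝ → ℝ≥0∞}, Measurable ρ → (∀ s, ρ s ≤ 1) →
      (∀ s, ρ s * ENNReal.ofReal (s + 1) ≤ ENNReal.ofReal M) →
      (∀ s ∉ Ioo (-1 / 2) (2 * L - 1), ρ s = 0) →
      ∃ P Q : ℝ≥0∞, P ^ 2 ≤ 108 * ENNReal.ofReal M * (∫⁻ s, ρ s) * X ∧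
        Q ^ 2 ≤ 4 * (∫⁻ s, ρ s) * E ∧
        ENNReal.ofReal (θ / 8) * ∫⁻ s, ρ s ≤ P + Q + ENNReal.ofReal θ * (4 * V)) ∧
    (∀ {ρ : ℝ → ℝ≥0∞}, Measurable ρ → (∀ s, ρ s ≤ 1) →
      (∀ s, ρ s * ENNReal.ofReal (s + 1) ≤ ENNReal.ofReal 1) →
      (∀ s ∉ Ioo 0 (2 * L - 1), ρ s = 0) →
      ∃ P Q : ℝ≥0∞, P ^ 2 ≤ 108 * (∫⁻ s, ρ s) * X ∧
        Q ^ 2 ≤ 4 * ENNReal.ofReal (2 * L - 1) * E ∧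
        ENNReal.ofReal (θ / 8) * ENNReal.ofReal (2 * L - 1) * ∫⁻ s, ρ s ≤
          ENNReal.ofReal (2 * L - 1) * P +
          (∫⁻ s, ρ s) * (ENNReal.ofReal (2 * L - 1) * (4 * V) + Q + ENNReal.ofReal θ * (4 * V))) := by
  have H := hasSmoothApprox_of_admissible hu
  rw [← hV] at H
  obtain ⟨⟨-, G, hG, -⟩, -⟩ := hu
  have hw := isWeakGradient_weakGradient ⟨G, hG⟩
  set D := weakGradient u
  set g₀ : Plane → ℝ := fun x => D x 0 0 + D x 0 1 with hg₀
  set g₁ : Plane → ℝ := fun x => D x 1 0 + D x 1 1 with hg₁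
  have m₀ : AEStronglyMeasurable g₀ volume :=
    (hw.2.1 0 0).aestronglyMeasurable.add (hw.2.1 0 1).aestronglyMeasurable
  have m₁ : AEStronglyMeasurable g₁ volume :=
    (hw.2.1 1 0).aestronglyMeasurable.add (hw.2.1 1 1).aestronglyMeasurable
  have enormSq : ∀ {a b : ℝ}, a ^ 2 ≤ 4 * b → ‖a‖ₑ ^ 2 ≤ 4 * ENNReal.ofReal b := by
    intro a b hab
    rw [← ofReal_norm, ← ENNReal.ofReal_pow (norm_nonneg _), Real.norm_eq_abs, sq_abs]
    refine (ENNReal.ofReal_le_ofReal hab).trans (le_of_eq ?_)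
    rw [ENNReal.ofReal_mul (by norm_num)]
    simp
  have n₀ : ∀ x, ‖g₀ x‖ₑ ^ 2 ≤ 4 * ENNReal.ofReal (normSq (D x)) := fun x =>
    enormSq (normSq_bounds (D x)).1
  have n₁ : ∀ x, ‖g₁ x‖ₑ ^ 2 ≤ 4 * ENNReal.ofReal (normSq (D x)) := fun x =>
    enormSq (normSq_bounds (D x)).2.1
  have n₂ : ∀ x, ‖g₀ x + g₁ x‖ₑ ^ 2 ≤ 4 * ENNReal.ofReal (normSq (D x)) := fun x =>
    enormSq (normSq_bounds (D x)).2.2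
  have n₃ : ∀ x, ENNReal.ofReal (wellDist θ (g₀ x + g₁ x)) ^ 2 ≤ 4 * ENNReal.ofReal
      (min (normSq (strain u x - θ • e₁e₂)) (normSq (strain u x + (1 - θ) • e₁e₂))) := fun x => by
    have := enormSq (sq_wellDist_le θ (D x))
    rwa [Real.enorm_of_nonneg (wellDist_nonneg _ _)] at this
  refine ⟨fun {M ρ} hρ hρ1 hρM hρS => ?_, fun {ρ} hρ hρ1 hρM hρS => ?_⟩
  · refine ⟨loopExterior L g₀ g₁ ρ, crossWellDist L θ g₀ g₁ ρ, ?_, ?_, ?_⟩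
    · rw [hX]; exact sq_loopExterior_le hρ (fun s _ => hρM s) hρS m₀ m₁ n₀ n₁ n₂
    · rw [hE]; exact sq_crossWellDist_le hρ hρ1 hρS m₀ m₁ n₃
    · exact weighted_lower_bound H hθ hθ' hρ hρ1 hρS m₀ m₁
  · have hS : ∀ s ∉ Ioo (-1 / 2) (2 * L - 1), s ∉ Ioo 0 (2 * L - 1) := fun s hs h =>
      hs (Ioo_subset_Ioo (by norm_num) le_rfl h)
    refine ⟨loopExterior L g₀ g₁ ρ, crossWellDist L θ g₀ g₁ ((Ioo 0 (2 * L - 1)).indicator 1),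
      ?_, ?_, averaged_lower_bound H hθ hθ' hρ hρ1 hρS m₀ m₁⟩
    · have := sq_loopExterior_le hρ (fun s _ => hρM s) (fun s hs => hρS s (hS s hs)) m₀ m₁ n₀ n₁ n₂
      rwa [ENNReal.ofReal_one, mul_one, ← hX] at this
    · have := sq_crossWellDist_le (L := L) (ρ := (Ioo 0 (2 * L - 1)).indicator 1)
        (measurable_one.indicator measurableSet_Ioo)
        (fun s => indicator_le_self' (fun _ _ => zero_le) s)
        (fun s hs => indicator_of_notMem (hS s hs) _) m₀ m₁ n₃
      rwa [lintegral_indicator_one measurableSet_Ioo, Real.volume_Ioo, sub_zero, ← hE] at this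

/-- Passing to real numbers when the energy is finite. -/
theorem exists_real_energy (hμ : 0 < μ) (hε : 0 < ε) (hE : energy μ ε θ L u ≠ ⊤) :
    ∃ x e v : ℝ, 0 ≤ x ∧ 0 ≤ e ∧ 0 ≤ v ∧
      ENNReal.ofReal x = ∫⁻ x in (nucleus L)ᶜ, ENNReal.ofReal (normSq (weakGradient u x)) ∧
      ENNReal.ofReal e = (∫⁻ x in nucleus L, ENNReal.ofReal
        (min (normSq (strain u x - θ • e₁e₂)) (normSq (strain u x + (1 - θ) • e₁e₂)))) ∧
      ENNReal.ofReal v = totalVariation (nucleus L)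
        (fun x (p : Fin 2 × Fin 2) => weakGradient u x p.1 p.2) ∧
      energy μ ε θ L u = ENNReal.ofReal (μ * x + e + ε * v) := by
  unfold energy at hE ⊢
  set X := ∫⁻ x in (nucleus L)ᶜ, ENNReal.ofReal (normSq (weakGradient u x))
  set E := ∫⁻ x in nucleus L, ENNReal.ofReal
    (min (normSq (strain u x - θ • e₁e₂)) (normSq (strain u x + (1 - θ) • e₁e₂)))
  set V := totalVariation (nucleus L) (fun x (p : Fin 2 × Fin 2) => weakGradient u x p.1 p.2)
  have hμ' : ENNReal.ofReal μ ≠ 0 := by simpa using hμ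
  have hε' : ENNReal.ofReal ε ≠ 0 := by simpa using hε
  have hXt : X ≠ ⊤ := by
    intro h
    simp [h, ENNReal.mul_top hμ'] at hE
  have hEt : E ≠ ⊤ := by
    intro h
    simp [h] at hE
  have hVt : V ≠ ⊤ := by
    intro h
    simp [h, ENNReal.mul_top hε'] at hE
  refine ⟨X.toReal, E.toReal, V.toReal, ENNReal.toReal_nonneg, ENNReal.toReal_nonneg,
    ENNReal.toReal_nonneg, ENNReal.ofReal_toReal hXt, ENNReal.ofReal_toReal hEt,
    ENNReal.ofReal_toReal hVt, ?_⟩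
  rw [ENNReal.ofReal_add (by positivity) (by positivity), ENNReal.ofReal_add (by positivity)
    (by positivity), ENNReal.ofReal_mul hμ.le, ENNReal.ofReal_mul hε.le, ENNReal.ofReal_toReal hXt,
    ENNReal.ofReal_toReal hEt, ENNReal.ofReal_toReal hVt]

theorem exists_real_of_sq_le {P : ℝ≥0∞} {y : ℝ} (hy : 0 ≤ y) (h : P ^ 2 ≤ ENNReal.ofReal y) :
    ∃ p : ℝ, 0 ≤ p ∧ P = ENNReal.ofReal p ∧ p ^ 2 ≤ y := by
  have hP : P ≠ ⊤ := by
    rintro rfl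
    simp at h
  refine ⟨P.toReal, ENNReal.toReal_nonneg, (ENNReal.ofReal_toReal hP).symm, ?_⟩
  rw [← ENNReal.ofReal_toReal hP, ← ENNReal.ofReal_pow ENNReal.toReal_nonneg,
    ENNReal.ofReal_le_ofReal_iff hy] at h
  exact h

/-- The lower bound from the loops with weight `M / (M + s + 1)`, `M = max 1 μ`. -/
theorem energy_ge_log (hu : u ∈ admissible L) (hμ : 0 < μ) (hε : 0 < ε) (hθ : 0 < θ)
    (hθ' : θ ≤ 1 / 2) (hL : 1 / 2 ≤ L) (hmin : min (θ ^ 2) (μ * θ ^ 2) ≤ ε) {x e v : ℝ}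
    (hx : 0 ≤ x) (he : 0 ≤ e) (hv : 0 ≤ v)
    (hX : ENNReal.ofReal x = ∫⁻ x in (nucleus L)ᶜ, ENNReal.ofReal (normSq (weakGradient u x)))
    (hE : ENNReal.ofReal e = ∫⁻ x in nucleus L, ENNReal.ofReal
      (min (normSq (strain u x - θ • e₁e₂)) (normSq (strain u x + (1 - θ) • e₁e₂))))
    (hV : ENNReal.ofReal v = totalVariation (nucleus L)
      (fun x (p : Fin 2 × Fin 2) => weakGradient u x p.1 p.2)) :
    1 / 70000 * (μ * θ ^ 2 * Real.log (1 + L / (2 * max 1 μ))) ≤ μ * x + e + ε * v := by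
  set M := max 1 μ with hMdef
  have hM1 : 1 ≤ M := le_max_left _ _
  have hMμ : μ ≤ M := le_max_right _ _
  have hM : 0 < M := by linarith
  have hI := lintegral_logWeight (M := M) (a := -1 / 2) (b := 2 * L - 1) hM (by norm_num)
    (by linarith)
  set Λ := M * Real.log ((M + (2 * L - 1) + 1) / (M + -1 / 2 + 1)) with hΛdef
  have hlog : Real.log (1 + L / (2 * M)) ≤
      Real.log ((M + (2 * L - 1) + 1) / (M + -1 / 2 + 1)) := by
    refine Real.log_le_log (by positivity) ?_
    rw [le_div_iff₀ (by linarith), add_mul, one_mul]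
    have : L / (2 * M) * (M + -1 / 2 + 1) ≤ L := by
      rw [div_mul_eq_mul_div, div_le_iff₀ (by positivity)]
      nlinarith
    linarith
  have hlog0 : 0 ≤ Real.log (1 + L / (2 * M)) := Real.log_nonneg (by
    have : 0 ≤ L / (2 * M) := by positivity
    linarith)
  have hΛ : 0 ≤ Λ := mul_nonneg hM.le (hlog0.trans hlog)
  obtain ⟨P, Q, hP, hQ, h⟩ := (energy_inequalities hu hθ hθ' hX hE hV).1
    (measurable_logWeight M (-1 / 2) (2 * L - 1)) (logWeight_le_one hM (by norm_num))
    (logWeight_mul_le hM (by norm_num)) fun s hs => logWeight_of_notMem hs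
  rw [hI] at hP hQ h
  have n108 : (108 : ℝ≥0∞) = ENNReal.ofReal 108 := by simp
  have n4 : (4 : ℝ≥0∞) = ENNReal.ofReal 4 := by simp
  rw [n108, ← ENNReal.ofReal_mul (by norm_num), ← ENNReal.ofReal_mul (by positivity),
    ← ENNReal.ofReal_mul (by positivity)] at hP
  rw [n4, ← ENNReal.ofReal_mul (by norm_num), ← ENNReal.ofReal_mul (by positivity)] at hQ
  obtain ⟨p, hp0, rfl, hp⟩ := exists_real_of_sq_le (by positivity) hP
  obtain ⟨q, hq0, rfl, hq⟩ := exists_real_of_sq_le (by positivity) hQ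
  have n4v : 4 * ENNReal.ofReal v = ENNReal.ofReal (4 * v) := by
    rw [n4, ← ENNReal.ofReal_mul (by norm_num)]
  rw [n4v, ← ENNReal.ofReal_mul hθ.le,
    ← ENNReal.ofReal_mul (by positivity), ← ENNReal.ofReal_add hp0 hq0,
    ← ENNReal.ofReal_add (by positivity) (by positivity),
    ENNReal.ofReal_le_ofReal_iff (by positivity)] at h
  -- `μ * θ ^ 2 / M` is the minimum of `θ ^ 2` and `μ * θ ^ 2`, since `M = max 1 μ`
  have hmle : μ * θ ^ 2 / M ≤ ε := by
    refine le_trans (le_min ?_ ?_) hmin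
    · rw [div_le_iff₀ hM]; nlinarith [sq_nonneg θ]
    · exact div_le_self (by positivity) hM1
  have key := energy_bound_of_weighted (m := μ * θ ^ 2 / M) hθ hμ hε hM hΛ hx he hv le_rfl
    (by rw [div_le_iff₀ hM]; nlinarith [sq_nonneg θ]) hmle hp hq h
  refine le_trans ?_ key
  have : μ * θ ^ 2 / M * Λ =
      μ * θ ^ 2 * Real.log ((M + (2 * L - 1) + 1) / (M + -1 / 2 + 1)) := by
    rw [hΛdef]; field_simp
  rw [this]
  gcongr

/-- The lower bound from comparing all crossings with each other. It does not need `ε` to be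
large. -/
theorem energy_ge_min (hu : u ∈ admissible L) (hμ : 0 < μ) (hε : 0 < ε) (hθ : 0 < θ)
    (hθ' : θ ≤ 1 / 2) (hL : 1 ≤ L) {x e v : ℝ} (hx : 0 ≤ x) (he : 0 ≤ e) (hv : 0 ≤ v)
    (hX : ENNReal.ofReal x = ∫⁻ x in (nucleus L)ᶜ, ENNReal.ofReal (normSq (weakGradient u x)))
    (hE : ENNReal.ofReal e = ∫⁻ x in nucleus L, ENNReal.ofReal
      (min (normSq (strain u x - θ • e₁e₂)) (normSq (strain u x + (1 - θ) • e₁e₂))))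
    (hV : ENNReal.ofReal v = totalVariation (nucleus L)
      (fun x (p : Fin 2 × Fin 2) => weakGradient u x p.1 p.2)) :
    1 / 70000 * min (μ * θ ^ 2 * Real.log (1 + L / 2)) (min (θ ^ 2 * L) (ε * θ)) ≤
      μ * x + e + ε * v := by
  have hI := lintegral_logWeight (M := 1) (a := 0) (b := 2 * L - 1) one_pos (by norm_num)
    (by linarith)
  set Λ := 1 * Real.log ((1 + (2 * L - 1) + 1) / (1 + 0 + 1)) with hΛdef
  have hlog : Real.log (1 + L / 2) ≤ Λ := by
    rw [hΛdef, one_mul]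
    exact Real.log_le_log (by positivity) (by linarith)
  have hΛ : 0 < Λ := (Real.log_pos (by linarith)).trans_le hlog
  have hℓ : 1 ≤ 2 * L - 1 := by linarith
  obtain ⟨P, Q, hP, hQ, h⟩ := (energy_inequalities hu hθ hθ' hX hE hV).2
    (measurable_logWeight 1 0 (2 * L - 1)) (logWeight_le_one one_pos (by norm_num))
    (logWeight_mul_le one_pos (by norm_num)) fun s hs => logWeight_of_notMem hs
  rw [hI] at hP h
  set ℓ := 2 * L - 1 with hℓdef
  have n108 : (108 : ℝ≥0∞) = ENNReal.ofReal 108 := by simp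
  have n4 : (4 : ℝ≥0∞) = ENNReal.ofReal 4 := by simp
  rw [n108, ← ENNReal.ofReal_mul (by norm_num), ← ENNReal.ofReal_mul (by positivity)] at hP
  rw [n4, ← ENNReal.ofReal_mul (by norm_num), ← ENNReal.ofReal_mul (by positivity)] at hQ
  obtain ⟨p, hp0, rfl, hp⟩ := exists_real_of_sq_le (by positivity) hP
  obtain ⟨q, hq0, rfl, hq⟩ := exists_real_of_sq_le (by positivity) hQ
  have n4v : 4 * ENNReal.ofReal v = ENNReal.ofReal (4 * v) := by
    rw [n4, ← ENNReal.ofReal_mul (by norm_num)]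
  rw [n4v, ← ENNReal.ofReal_mul hθ.le,
    ← ENNReal.ofReal_mul (by positivity), ← ENNReal.ofReal_mul (by positivity),
    ← ENNReal.ofReal_mul (by positivity), ← ENNReal.ofReal_mul (by positivity),
    ← ENNReal.ofReal_add (by positivity) hq0, ← ENNReal.ofReal_add (by positivity) (by positivity),
    ← ENNReal.ofReal_mul hΛ.le, ← ENNReal.ofReal_add (by positivity) (by positivity),
    ENNReal.ofReal_le_ofReal_iff (by positivity)] at h
  refine le_trans ?_ (energy_bound_of_averaged hθ hθ' hμ hε hΛ hℓ hx he hv hp hq h)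
  gcongr
  linarith

/-- The exponent `8` comes from `3 + z ≤ (1 + z / 2) ^ 8` for `z ≥ 1 / 2`. -/
theorem log_three_add_le {z : ℝ} (hz : 1 / 2 ≤ z) :
    Real.log (3 + z) ≤ 8 * Real.log (1 + z / 2) := by
  have h : 3 + z ≤ (1 + z / 2) ^ 8 := by
    have h1 : (1 + z / 2) ^ 8 = ((1 + z / 2) ^ 4) ^ 2 := by ring
    have h2 : 1 + 2 * z ≤ (1 + z / 2) ^ 4 := by
      have := one_add_mul_le_pow (a := z / 2) (by linarith) 4
      norm_num at this
      linarith
    rw [h1]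
    nlinarith [pow_le_pow_left₀ (by linarith) h2 2]
  calc Real.log (3 + z) ≤ Real.log ((1 + z / 2) ^ 8) := Real.log_le_log (by linarith) h
    _ = 8 * Real.log (1 + z / 2) := by rw [Real.log_pow]; norm_num

end EnergyBounds

end Nucleus

theorem mainTheorem3 :
    ∃ c : ℝ, 0 < c ∧
      ∀ μ ε θ L : ℝ, 0 < μ → 0 < ε → 0 < θ → θ ≤ 1 / 2 → 1 / 2 ≤ L →
        min (θ ^ 2) (μ * θ ^ 2) ≤ ε →
        ∀ u ∈ Nucleus.admissible L,
          ENNReal.ofReal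
            (c * min (μ * θ ^ 2 * Real.log (3 + L))
              (min (θ ^ 2 * L) (μ * θ ^ 2 * Real.log (3 + L / μ) + ε * θ)))
          ≤ Nucleus.energy μ ε θ L u := by
  -- `1120000 = 70000 * 8 * 2`: the energy bounds, the comparison of logarithms, and the sum of two
  -- lower bounds in the last case
  refine ⟨1 / 1120000, by norm_num, fun μ ε θ L hμ hε hθ hθ' hL hmin u hu => ?_⟩
  by_cases htop : Nucleus.energy μ ε θ L u = ⊤
  · rw [htop]; exact le_top
  obtain ⟨x, e, v, hx, he, hv, hX, hE, hV, hen⟩ := Nucleus.exists_real_energy hμ hε htop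
  rw [hen]
  refine ENNReal.ofReal_le_ofReal ?_
  have h1 := Nucleus.energy_ge_log hu hμ hε hθ hθ' hL hmin hx he hv hX hE hV
  set I := μ * x + e + ε * v
  set A := μ * θ ^ 2 * Real.log (3 + L)
  set B := θ ^ 2 * L with hB
  set C := μ * θ ^ 2 * Real.log (3 + L / μ) with hC
  have hA0 : 0 ≤ A := mul_nonneg (by positivity) (Real.log_nonneg (by linarith))
  have hB0 : 0 ≤ B := by positivity
  have hC0 : 0 ≤ C := mul_nonneg (by positivity) (Real.log_nonneg (by
    have : 0 ≤ L / μ := by positivity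
    linarith))
  have mA : min A (min B (C + ε * θ)) ≤ A := min_le_left _ _
  have mB : min A (min B (C + ε * θ)) ≤ B := (min_le_right _ _).trans (min_le_left _ _)
  have mC : min A (min B (C + ε * θ)) ≤ C + ε * θ := (min_le_right _ _).trans (min_le_right _ _)
  have hAlog : A ≤ 8 * (μ * θ ^ 2 * Real.log (1 + L / 2)) := by
    have := mul_le_mul_of_nonneg_left (Nucleus.log_three_add_le hL)
      (by positivity : 0 ≤ μ * θ ^ 2)
    linarith
  rcases le_total μ 1 with hμ1 | hμ1
  · rw [max_eq_left hμ1, mul_one] at h1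
    linarith
  rw [max_eq_right hμ1] at h1
  rcases le_total L μ with hLμ | hLμ
  · -- here `L / (2 μ) ≤ 1 / 2` and the logarithm is linear
    have h2 := Real.le_log_one_add_of_nonneg (by positivity : 0 ≤ L / (2 * μ))
    have h3 : L / (2 * μ) ≤ 1 / 2 := by rw [div_le_iff₀ (by positivity)]; linarith
    have h4 : L / (4 * μ) ≤ 2 * (L / (2 * μ)) / (L / (2 * μ) + 2) := by
      rw [le_div_iff₀ (by positivity)]
      have : L / (4 * μ) = L / (2 * μ) / 2 := by field_simp; norm_num
      rw [this]
      nlinarith [(by positivity : 0 ≤ L / (2 * μ))]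
    have h5 : μ * θ ^ 2 * (L / (4 * μ)) = B / 4 := by rw [hB]; field_simp
    have h6 := mul_le_mul_of_nonneg_left (h4.trans h2) (by positivity : 0 ≤ μ * θ ^ 2)
    linarith
  · have hz : 1 ≤ L / μ := by rwa [le_div_iff₀ hμ, one_mul]
    have e1 : L / (2 * μ) = L / μ / 2 := by field_simp
    rw [e1] at h1
    have hClog : C ≤ 8 * (μ * θ ^ 2 * Real.log (1 + L / μ / 2)) := by
      have := mul_le_mul_of_nonneg_left (Nucleus.log_three_add_le (z := L / μ) (by linarith))
        (by positivity : 0 ≤ μ * θ ^ 2)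
      linarith
    have h2 := Nucleus.energy_ge_min hu hμ hε hθ hθ' (hμ1.trans hLμ) hx he hv hX hE hV
    have hεθ : 0 < ε * θ := by positivity
    rcases min_choice (μ * θ ^ 2 * Real.log (1 + L / 2)) (min (θ ^ 2 * L) (ε * θ)) with h | h
    · rw [h] at h2
      linarith
    rw [h] at h2
    rcases min_choice (θ ^ 2 * L) (ε * θ) with h | h <;> rw [h] at h2 <;> linarith
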